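/- Let $k$ be an algebraically closed field of characteristic zero. For a closed subscheme $X\subset\mathbb P^2=\mathbb P^2_k$ with ideal sheaf $\mathcal I_X$ and an integer $d\ge 0$, write $h^0(\mathcal I_X(d))$ for the dimension of the space of forms of degree $d$ in the saturated homogeneous ideal of $X$. For a point $P\in\mathbb P^2$ and an integer $m\ge 0$, let $mP$ be the subscheme defined by $(\mathcal I_P)^m$ (empty for $m=0$). A $2$-dot is a subscheme of length $2$ of a double point $2Q$, $Q\in\mathbb P^2$. A $2$-dot is determined by its support $Q$ and the line through $Q$ which contains it, so the $2$-dots are parametrized by the incidence variety of points and lines in $\mathbb P^2\times(\mathbb P^2)^\vee$. Let $s,m,d\ge 0$ be integers with $d\ge m-1$, and let $X=mP+Z_1+\cdots+Z_s\subset\mathbb P^2$ be a generic schematic union of an $m$-multiple point $mP$ and $s$ $2$-dots $Z_1,\dots,Z_s$; that is, $(P,Z_1,\dots,Z_s)$ varies in a suitable nonempty, dense, Zariski-open subset (depending on $s,m,d$) of the parameter space of such tuples. Then $X$ has good postulation in degree $d$, i.e. $$h^0(\mathcal I_X(d))=\max\left\{\binom{d+2}{2}-\binom{m+1}{2}-2s,\;0\right\}.$$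 -/

import Mathlib

/-!
# Fat points, 2-dots and generic unions in the projective plane

Closed subschemes of `ℙⁿ` are represented by their saturated homogeneous ideals in
`k[x₀, …, xₙ]`. Under this dictionary `H⁰(ℙⁿ, 𝓘_X(d))` is the degree `d` part of the ideal,
inclusion of subschemes is reverse inclusion of ideals, and schematic union (intersection of
ideal sheaves) is intersection of ideals.
-/

namespace Postulation

open MvPolynomial

/-- A homogeneous ideal of `k[x₀, …, xₙ]`: it contains the homogeneous components of each of
its elements. -/
def IsHomogeneousIdeal {k : Type*} [Field k] {n : ℕ}
    (I : Ideal (MvPolynomial (Fin (n + 1)) k)) : Prop :=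
  ∀ F ∈ I, ∀ j : ℕ, homogeneousComponent j F ∈ I

/-- A closed subscheme of `ℙⁿ` over `k`, given by its saturated homogeneous ideal. -/
@[ext]
structure ClosedSubscheme (k : Type*) [Field k] (n : ℕ) where
  /-- The saturated homogeneous ideal `I_X`. -/
  ideal : Ideal (MvPolynomial (Fin (n + 1)) k)
  homogeneous : IsHomogeneousIdeal ideal
  saturated : ∀ F : MvPolynomial (Fin (n + 1)) k,
    (∀ i : Fin (n + 1), ∃ N : ℕ, X i ^ N * F ∈ ideal) → F ∈ ideal

/-- The saturation of an ideal with respect to the irrelevant ideal: the polynomials `F` which,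
for each standard chart `x_i ≠ 0`, lie in the ideal after inverting `x_i`. -/
def saturation {k : Type*} [Field k] {n : ℕ} (I : Ideal (MvPolynomial (Fin (n + 1)) k)) :
    Ideal (MvPolynomial (Fin (n + 1)) k) where
  carrier := {F | ∀ i : Fin (n + 1), ∃ N : ℕ, X i ^ N * F ∈ I}
  zero_mem' := fun i => ⟨0, by simp⟩
  add_mem' := by
    intro F G hF hG i
    obtain ⟨N, hN⟩ := hF i
    obtain ⟨M, hM⟩ := hG i
    refine ⟨N + M, ?_⟩
    have e : (X i ^ (N + M) * (F + G) : MvPolynomial (Fin (n + 1)) k) =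
        X i ^ M * (X i ^ N * F) + X i ^ N * (X i ^ M * G) := by ring
    rw [e]
    exact I.add_mem (I.mul_mem_left _ hN) (I.mul_mem_left _ hM)
  smul_mem' := by
    intro G F hF i
    obtain ⟨N, hN⟩ := hF i
    refine ⟨N, ?_⟩
    have e : (X i ^ N * (G • F) : MvPolynomial (Fin (n + 1)) k) = G * (X i ^ N * F) := by
      rw [smul_eq_mul]; ring
    rw [e]
    exact I.mul_mem_left _ hN

theorem isHomogeneousIdeal_iff {k : Type*} [Field k] {n : ℕ}
    (I : Ideal (MvPolynomial (Fin (n + 1)) k)) :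
    IsHomogeneousIdeal I ↔
      letI := MvPolynomial.gradedAlgebra (σ := Fin (n + 1)) (R := k)
      I.IsHomogeneous (homogeneousSubmodule (Fin (n + 1)) k) := by
  let := MvPolynomial.gradedAlgebra (σ := Fin (n + 1)) (R := k)
  constructor
  · intro h j F hF
    have h1 := h F hF j
    rw [← decomposition.decompose'_apply] at h1
    exact h1
  · intro h F hF j
    have h1 := h j hF
    rw [← decomposition.decompose'_apply]
    exact h1

theorem isHomogeneousIdeal_saturation {k : Type*} [Field k] {n : ℕ}
    {I : Ideal (MvPolynomial (Fin (n + 1)) k)} (hI : IsHomogeneousIdeal I) :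
    IsHomogeneousIdeal (saturation I) := by
  let := MvPolynomial.gradedAlgebra (σ := Fin (n + 1)) (R := k)
  intro F hF j i
  obtain ⟨N, hN⟩ := hF i
  refine ⟨N, ?_⟩
  have h1 : (X i ^ N : MvPolynomial (Fin (n + 1)) k) ∈
      homogeneousSubmodule (Fin (n + 1)) k N := isHomogeneous_X_pow i N
  have h2 := DirectSum.coe_decompose_mul_add_of_left_mem
    (homogeneousSubmodule (Fin (n + 1)) k) (j := j) (b := F) h1
  have h3 : homogeneousComponent (N + j) (X i ^ N * F) = X i ^ N * homogeneousComponent j F := by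
    rw [← decomposition.decompose'_apply, ← decomposition.decompose'_apply]
    exact h2
  rw [← h3]
  exact hI _ hN _

/-- The closed subscheme of `ℙⁿ` defined by an arbitrary homogeneous ideal `I`, that is, by the
ideal sheaf associated to `I`. -/
def ofIdeal {k : Type*} [Field k] {n : ℕ} (I : Ideal (MvPolynomial (Fin (n + 1)) k))
    (hI : IsHomogeneousIdeal I) : ClosedSubscheme k n where
  ideal := saturation I
  homogeneous := isHomogeneousIdeal_saturation hI
  saturated := by
    intro F hF i
    obtain ⟨N, hN⟩ := hF i
    obtain ⟨M, hM⟩ := hN i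
    exact ⟨M + N, by rw [pow_add, mul_assoc]; exact hM⟩

/-- `X` is a subscheme of `Y`. -/
def IsSubscheme {k : Type*} [Field k] {n : ℕ} (X Y : ClosedSubscheme k n) : Prop :=
  Y.ideal ≤ X.ideal

/-- The schematic union `X + Y`. -/
noncomputable def union {k : Type*} [Field k] {n : ℕ} (X Y : ClosedSubscheme k n) : ClosedSubscheme k n where
  ideal := X.ideal ⊓ Y.ideal
  homogeneous := fun F hF j => ⟨X.homogeneous F hF.1 j, Y.homogeneous F hF.2 j⟩
  saturated := fun F hF =>
    ⟨X.saturated F fun i => (hF i).imp fun _ h => h.1,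
      Y.saturated F fun i => (hF i).imp fun _ h => h.2⟩

/-- The schematic union of a family of closed subschemes (empty for the empty family). -/
noncomputable def iUnion {k : Type*} [Field k] {n : ℕ} {ι : Type*} (Z : ι → ClosedSubscheme k n) :
    ClosedSubscheme k n where
  ideal := ⨅ a, (Z a).ideal
  homogeneous := by
    intro F hF j
    rw [Ideal.mem_iInf] at hF ⊢
    exact fun a => (Z a).homogeneous F (hF a) j
  saturated := by
    intro F hF
    rw [Ideal.mem_iInf]
    intro a
    refine (Z a).saturated F fun i => (hF i).imp fun N h => ?_
    rw [Ideal.mem_iInf] at h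
    exact h a

/-- `h⁰(𝓘_X(d))`: the dimension of the space of forms of degree `d` in the saturated
homogeneous ideal of `X`. -/
noncomputable def h0 {k : Type*} [Field k] {n : ℕ} (X : ClosedSubscheme k n) (d : ℕ) : ℕ :=
  Module.finrank k
    (homogeneousSubmodule (Fin (n + 1)) k d ⊓ X.ideal.restrictScalars k :
      Submodule k (MvPolynomial (Fin (n + 1)) k))

/-- The Hilbert function `HF(X, d) = h⁰(𝓞(d)) - h⁰(𝓘_X(d))`. -/
noncomputable def hilbertFunction {k : Type*} [Field k] {n : ℕ} (X : ClosedSubscheme k n)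
    (d : ℕ) : ℤ :=
  (Module.finrank k (homogeneousSubmodule (Fin (n + 1)) k d) : ℤ) - (h0 X d : ℤ)

/-- `X` is zero-dimensional (or empty) of length `δ`: its Hilbert polynomial is the constant
`δ`. -/
def HasLength {k : Type*} [Field k] {n : ℕ} (X : ClosedSubscheme k n) (δ : ℕ) : Prop :=
  ∃ e₀ : ℕ, ∀ e ≥ e₀, hilbertFunction X e = (δ : ℤ)

/-- The homogeneous ideal `I_P` of a point `P ∈ ℙⁿ`, generated by the forms vanishing at `P`. -/
noncomputable def pointIdeal {k : Type*} [Field k] {n : ℕ}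
    (P : Projectivization k (Fin (n + 1) → k)) : Ideal (MvPolynomial (Fin (n + 1)) k) :=
  Ideal.span {F | (∃ e : ℕ, F.IsHomogeneous e) ∧ eval P.rep F = 0}

theorem isHomogeneousIdeal_pointIdeal_pow {k : Type*} [Field k] {n : ℕ}
    (P : Projectivization k (Fin (n + 1) → k)) (m : ℕ) :
    IsHomogeneousIdeal (pointIdeal P ^ m) := by
  let := MvPolynomial.gradedAlgebra (σ := Fin (n + 1)) (R := k)
  induction m with
  | zero =>
    intro F _ j
    simp
  | succ m ih =>
    rw [isHomogeneousIdeal_iff] at ih ⊢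
    rw [pow_succ]
    refine Ideal.IsHomogeneous.mul ih (Ideal.homogeneous_span _ _ ?_)
    rintro F ⟨⟨e, he⟩, -⟩
    exact ⟨e, he⟩

/-- The `m`-multiple point `mP`, defined by the ideal sheaf `(𝓘_P)^m`. -/
noncomputable def fatPoint {k : Type*} [Field k] {n : ℕ} (m : ℕ)
    (P : Projectivization k (Fin (n + 1) → k)) : ClosedSubscheme k n :=
  ofIdeal (pointIdeal P ^ m) (isHomogeneousIdeal_pointIdeal_pow P m)

/-- A `δ`-dot: a subscheme of length `δ` of a double point. -/
def IsDot {k : Type*} [Field k] {n : ℕ} (δ : ℕ) (Z : ClosedSubscheme k n) : Prop :=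
  (∃ Q : Projectivization k (Fin (n + 1) → k), IsSubscheme Z (fatPoint 2 Q)) ∧ HasLength Z δ

/-- A configuration in `ℙ²`: a point `P` and `s` 2-dots `Z₁, …, Z_s`. -/
structure Configuration (k : Type*) [Field k] (s : ℕ) where
  /-- The point `P`. -/
  point : Projectivization k (Fin 3 → k)
  /-- The 2-dots `Z₁, …, Z_s`. -/
  dot : Fin s → ClosedSubscheme k 2
  isDot : ∀ i, IsDot 2 (dot i)

/-- The scheme `mP + Z₁ + ⋯ + Z_s`. -/
noncomputable def Configuration.scheme {k : Type*} [Field k] {s : ℕ}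
    (x : Configuration k s) (m : ℕ) : ClosedSubscheme k 2 :=
  union (fatPoint m x.point) (iUnion x.dot)

/-- The blocks of homogeneous coordinates on the parameter space of configurations: one for the
point `P`, one for the support of each dot, one for the line spanned by each dot. -/
inductive Block (s : ℕ) : Type
  | point : Block s
  | support : Fin s → Block s
  | line : Fin s → Block s

/-- `c` is a system of homogeneous coordinates of the configuration `x`. A 2-dot `Z` of `ℙ²` is
determined by its support `Q` (the point with `Z ⊆ 2Q`) and by the line
`a₀x₀ + a₁x₁ + a₂x₂ = 0` through `Q` which contains `Z`; so the 2-dots are parametrized by the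
incidence variety of points and lines in `ℙ² × (ℙ²)^∨`, and configurations by a closed
subvariety of a product of `2s + 1` projective planes. -/
def Configuration.IsCoordinates {k : Type*} [Field k] {s : ℕ} (x : Configuration k s)
    (c : Block s → Fin 3 → k) : Prop :=
  (∃ h : c Block.point ≠ 0, Projectivization.mk k (c Block.point) h = x.point) ∧
    ∀ i : Fin s,
      (∃ h : c (Block.support i) ≠ 0,
        IsSubscheme (x.dot i) (fatPoint 2 (Projectivization.mk k (c (Block.support i)) h))) ∧
      c (Block.line i) ≠ 0 ∧ ∑ j : Fin 3, C (c (Block.line i) j) * X j ∈ (x.dot i).ideal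

/-- Multihomogeneous polynomials in the blocks of coordinates, of multidegree `e`. -/
def IsMultihomogeneous {k : Type*} [Field k] {s : ℕ}
    (g : MvPolynomial (Block s × Fin 3) k) (e : Block s →₀ ℕ) : Prop :=
  IsWeightedHomogeneous (fun v : Block s × Fin 3 => Finsupp.single v.1 1) g e

/-- The locus of configurations where the multihomogeneous polynomial `g` does not vanish. -/
def basicOpen {k : Type*} [Field k] {s : ℕ} (g : MvPolynomial (Block s × Fin 3) k) :
    Set (Configuration k s) :=
  {x | ∃ c : Block s → Fin 3 → k, x.IsCoordinates c ∧ eval (fun v => c v.1 v.2) g ≠ 0}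

/-- The Zariski topology on the parameter space of configurations: the open sets are the unions
of nonvanishing loci of multihomogeneous polynomials. -/
instance zariskiTopology (k : Type*) [Field k] (s : ℕ) :
    TopologicalSpace (Configuration k s) :=
  TopologicalSpace.generateFrom
    {U | ∃ (g : MvPolynomial (Block s × Fin 3) k) (e : Block s →₀ ℕ),
      IsMultihomogeneous g e ∧ U = basicOpen g}

/-- A property holds for the generic configuration if it holds on a nonempty, dense,
Zariski-open set of configurations. -/
def ForGeneric {k : Type*} [Field k] {s : ℕ} (p : Configuration k s → Prop) : Prop :=
  ∃ U : Set (Configuration k s), IsOpen U ∧ U.Nonempty ∧ Dense U ∧ ∀ x ∈ U, p x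

end Postulation

/-! The multiple point imposes `(m+1).choose 2` independent conditions on forms of degree `d ≥ m -
1`, and each dot imposes at most two, so the right-hand side bounds `h0` from below. It remains to
find one configuration attaining the bound, to see that attaining it is an open condition, and to
see that nonempty open sets are dense.

Existence. Dots are added one at a time to a linear system `V`
(`exists_frame_finrank_inf_comap_dot_le`). If `V` contains independent forms `F`, `G`, subtract a
multiple of `F` from `G` so that the result vanishes at a point where `F` does not. On a line
through that point where the difference is not identically zero, the Wronskian of the two
restrictions is nonzero, by comparing orders of vanishing in characteristic zero. At a point of the
line where it does not vanish, value and derivative along the line are independent on `V`, and the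
dot there lowers the dimension by two. A system of dimension one is killed by a point where its form
does not vanish.

Openness. In a frame adapted to the point or to the dot, the schemes become the monomial ideals
`(x₁, x₂)^m` and `(x₁², x₂)` (`mem_fatPoint_iff`, `mem_dot_iff`), so the conditions are vanishing
coefficients. The frame of a dot with support `q` on the line `a` is `q`, `u × a`, `w` with `u`, `w`
fixed once and for all. Its entries are multihomogeneous in the coordinates, hence so are the minors
of the matrix of conditions. A minor that is nonzero at the good configuration, times the
determinants of the frames, cuts out the required open set.

Density. Coordinates of configurations are parametrized by an affine space, replacing each line by
the cross product of a free vector with the support. Nonempty basic open sets pull back to nonzero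
polynomials, and a product of nonzero polynomials over an infinite field is nonzero somewhere
(`dense_basicOpen`). -/

namespace Postulation

open MvPolynomial

/-! ### Linear changes of coordinates -/

section Frame

variable {R : Type*} [CommRing R]

/-- Substitution of the coordinates with respect to the frame formed by the rows of `M`:
`F` is sent to `F(y₀ M₀ + y₁ M₁ + y₂ M₂)`. -/
noncomputable def frameSubst (M : Matrix (Fin 3) (Fin 3) R) :
    MvPolynomial (Fin 3) R →ₐ[R] MvPolynomial (Fin 3) R :=
  aeval fun j => ∑ i, C (M i j) * X i

theorem frameSubst_X (M : Matrix (Fin 3) (Fin 3) R) (j : Fin 3) :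
    frameSubst M (X j) = ∑ i, C (M i j) * X i := by
  simp [frameSubst]

theorem frameSubst_C (M : Matrix (Fin 3) (Fin 3) R) (r : R) :
    frameSubst M (C r) = C r :=
  (frameSubst M).commutes r

theorem frameSubst_frameSubst (N M : Matrix (Fin 3) (Fin 3) R) (F : MvPolynomial (Fin 3) R) :
    frameSubst N (frameSubst M F) = frameSubst (N * M) F := by
  suffices (frameSubst N).comp (frameSubst M) = frameSubst (N * M) from DFunLike.congr_fun this F
  refine algHom_ext fun j => ?_
  simp only [AlgHom.comp_apply, frameSubst_X, map_add, map_mul, frameSubst_C, Matrix.mul_apply,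
    Fin.sum_univ_three]
  ring

theorem frameSubst_one (F : MvPolynomial (Fin 3) R) : frameSubst 1 F = F := by
  have : frameSubst (1 : Matrix (Fin 3) (Fin 3) R) = AlgHom.id R _ := by
    refine algHom_ext fun j => ?_
    rw [frameSubst_X, AlgHom.id_apply, Finset.sum_eq_single j]
    · simp
    · intro i _ hij
      simp [Matrix.one_apply_ne hij]
    · simp
  rw [this, AlgHom.id_apply]

theorem frameSubst_of_mul_eq_one {N M : Matrix (Fin 3) (Fin 3) R} (h : N * M = 1)
    (F : MvPolynomial (Fin 3) R) : frameSubst N (frameSubst M F) = F := by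
  rw [frameSubst_frameSubst, h, frameSubst_one]

theorem eval_frameSubst (M : Matrix (Fin 3) (Fin 3) R) (y : Fin 3 → R)
    (F : MvPolynomial (Fin 3) R) :
    eval y (frameSubst M F) = eval (Matrix.vecMul y M) F := by
  have : (aeval y).comp (frameSubst M) = aeval (Matrix.vecMul y M) := by
    refine algHom_ext fun j => ?_
    simp only [AlgHom.comp_apply, frameSubst_X, map_sum, map_mul, aeval_X, aeval_C,
      Matrix.vecMul, dotProduct, Algebra.algebraMap_self_apply, mul_comm]
  simpa [aeval_eq_eval] using DFunLike.congr_fun this F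

theorem isHomogeneous_frameSubst (M : Matrix (Fin 3) (Fin 3) R) {F : MvPolynomial (Fin 3) R}
    {d : ℕ} (hF : F.IsHomogeneous d) : (frameSubst M F).IsHomogeneous d := by
  have h := hF.aeval (n := 1) (fun j => ∑ i, C (M i j) * X i) fun j =>
    IsHomogeneous.sum _ _ _ fun i _ => isHomogeneous_C_mul_X _ _
  rwa [one_mul] at h

theorem homogeneousComponent_frameSubst (M : Matrix (Fin 3) (Fin 3) R)
    (F : MvPolynomial (Fin 3) R) (j : ℕ) :
    homogeneousComponent j (frameSubst M F) = frameSubst M (homogeneousComponent j F) := by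
  conv_lhs => rw [← sum_homogeneousComponent F, map_sum, map_sum]
  have h : ∀ i, homogeneousComponent j (frameSubst M (homogeneousComponent i F)) =
      if i = j then frameSubst M (homogeneousComponent i F) else 0 := by
    intro i
    rw [homogeneousComponent_of_mem
      (isHomogeneous_frameSubst M (homogeneousComponent_isHomogeneous i F))]
    simp [eq_comm]
  simp only [h, Finset.sum_ite_eq', Finset.mem_range]
  split_ifs with hj
  · rfl
  · rw [homogeneousComponent_eq_zero _ _ (by omega), map_zero]

end Frame

/-! ### Monomial ideals -/

section ExponentIdeal

variable {k : Type*} [Field k]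

/-- The ideal of the polynomials all of whose monomials have exponents in the upper set `T`. -/
def exponentIdeal (k : Type*) [Field k] (T : UpperSet (Fin 3 →₀ ℕ)) :
    Ideal (MvPolynomial (Fin 3) k) where
  carrier := {G | ∀ α, α ∉ T → coeff α G = 0}
  zero_mem' := by simp
  add_mem' := by
    intro F G hF hG α hα
    rw [coeff_add, hF α hα, hG α hα, add_zero]
  smul_mem' := by
    intro F G hG α hα
    rw [smul_eq_mul, coeff_mul]
    refine Finset.sum_eq_zero fun x hx => ?_
    rw [hG x.2, mul_zero]
    intro h
    refine hα (T.upper ?_ h)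
    rw [← Finset.HasAntidiagonal.mem_antidiagonal.1 hx]
    exact le_add_self

theorem monomial_mem_exponentIdeal {T : UpperSet (Fin 3 →₀ ℕ)} {α : Fin 3 →₀ ℕ} (hα : α ∈ T)
    (r : k) : monomial α r ∈ exponentIdeal k T := by
  intro β hβ
  rw [coeff_monomial, if_neg]
  rintro rfl
  exact hβ hα

theorem homogeneousComponent_mem_exponentIdeal {T : UpperSet (Fin 3 →₀ ℕ)}
    {G : MvPolynomial (Fin 3) k} (hG : G ∈ exponentIdeal k T) (j : ℕ) :
    homogeneousComponent j G ∈ exponentIdeal k T := by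
  intro α hα
  rw [coeff_homogeneousComponent, hG α hα, ite_self]

/-- Linear forms that do not vanish at `(1, 0, 0)` are nonzerodivisors modulo a monomial ideal
whose exponents do not involve the first variable. -/
theorem mem_exponentIdeal_of_linear_mul_mem {T : UpperSet (Fin 3 →₀ ℕ)}
    (hT : ∀ α, α + Finsupp.single 0 1 ∈ T → α ∈ T) {a : Fin 3 → k} (ha : a 0 ≠ 0)
    {G : MvPolynomial (Fin 3) k} (hG : (∑ i, C (a i) * X i) * G ∈ exponentIdeal k T) :
    G ∈ exponentIdeal k T := by
  -- Induction on the degree in the last two variables. In the coefficient of the product at `α +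
  -- (1, 0, 0)`, the terms from `x₁` and `x₂` involve coefficients of `G` of smaller such degree,
  -- still outside `T`; only `a 0 * coeff α G` survives.
  have key : ∀ n : ℕ, ∀ α : Fin 3 →₀ ℕ, α 1 + α 2 = n → α ∉ T → coeff α G = 0 := by
    intro n
    induction n using Nat.strong_induction_on with
    | _ n ih =>
      intro α hn hα
      have hα' : α + Finsupp.single 0 1 ∉ T := fun h => hα (hT α h)
      have h := hG _ hα'
      have aux : ∀ i : Fin 3, i ≠ 0 →
          coeff (α + Finsupp.single (0 : Fin 3) 1) (C (a i) * X i * G) = 0 := by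
        intro i hi
        rw [mul_assoc, coeff_C_mul, coeff_X_mul']
        split_ifs with hs
        · have hs' : (α + Finsupp.single (0 : Fin 3) 1 : Fin 3 →₀ ℕ) i ≠ 0 :=
            Finsupp.mem_support_iff.1 hs
          rw [ih ((α + Finsupp.single 0 1 - Finsupp.single i 1 : Fin 3 →₀ ℕ) 1 +
            (α + Finsupp.single 0 1 - Finsupp.single i 1 : Fin 3 →₀ ℕ) 2) ?_ _ rfl, mul_zero]
          · exact fun h => hα' (T.upper tsub_le_self h)
          · fin_cases i
            · exact absurd rfl hi
            · simp at hs' ⊢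
              omega
            · simp at hs' ⊢
              omega
        · rw [mul_zero]
      rw [Fin.sum_univ_three, add_mul, add_mul, coeff_add, coeff_add, aux 1 (by decide),
        aux 2 (by decide), add_zero, add_zero, mul_assoc, coeff_C_mul, mul_comm (X 0) G,
        coeff_mul_X] at h
      exact (mul_eq_zero.1 h).resolve_left ha
  exact fun α hα => key _ α rfl hα

theorem mem_exponentIdeal_of_linear_pow_mul_mem {T : UpperSet (Fin 3 →₀ ℕ)}
    (hT : ∀ α, α + Finsupp.single 0 1 ∈ T → α ∈ T) {a : Fin 3 → k} (ha : a 0 ≠ 0) (N : ℕ)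
    {G : MvPolynomial (Fin 3) k} (hG : (∑ i, C (a i) * X i) ^ N * G ∈ exponentIdeal k T) :
    G ∈ exponentIdeal k T := by
  induction N with
  | zero => simpa using hG
  | succ N ih =>
    rw [pow_succ', mul_assoc] at hG
    exact ih (mem_exponentIdeal_of_linear_mul_mem hT ha hG)

/-- The exponents of order at least `m` in the last two variables. -/
def fatExponents (m : ℕ) : UpperSet (Fin 3 →₀ ℕ) where
  carrier := {α | m ≤ α 1 + α 2}
  upper' := by
    intro α β h hα
    have h1 := h 1
    have h2 := h 2
    simp only [Set.mem_ofPred_eq] at hα ⊢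
    omega

/-- The exponents of the monomials in `(x₁², x₂)`. -/
def dotExponents : UpperSet (Fin 3 →₀ ℕ) where
  carrier := {α | 2 ≤ α 1 ∨ 1 ≤ α 2}
  upper' := by
    intro α β h hα
    have h1 := h 1
    have h2 := h 2
    simp only [Set.mem_ofPred_eq] at hα ⊢
    omega

theorem mem_fatExponents {m : ℕ} {α : Fin 3 →₀ ℕ} : α ∈ fatExponents m ↔ m ≤ α 1 + α 2 := Iff.rfl

theorem mem_dotExponents {α : Fin 3 →₀ ℕ} : α ∈ dotExponents ↔ 2 ≤ α 1 ∨ 1 ≤ α 2 := Iff.rfl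

theorem mul_mem_exponentIdeal_fatExponents {m n : ℕ} {F G : MvPolynomial (Fin 3) k}
    (hF : F ∈ exponentIdeal k (fatExponents m)) (hG : G ∈ exponentIdeal k (fatExponents n)) :
    F * G ∈ exponentIdeal k (fatExponents (m + n)) := by
  intro α hα
  rw [coeff_mul]
  refine Finset.sum_eq_zero fun x hx => ?_
  rw [← Finset.HasAntidiagonal.mem_antidiagonal.1 hx] at hα
  by_cases h : x.1 ∈ fatExponents m
  · rw [hG x.2, mul_zero]
    rw [mem_fatExponents] at *
    simp only [Finsupp.add_apply] at hα
    omega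
  · rw [hF _ h, zero_mul]

end ExponentIdeal

/-! ### Fat points in an adapted frame -/

section FatPoint

variable {k : Type*} [Field k]

theorem eval_smul_of_isHomogeneous {F : MvPolynomial (Fin 3) k} {d : ℕ} (hF : F.IsHomogeneous d)
    (r : k) (q : Fin 3 → k) : eval (r • q) F = r ^ d * eval q F := by
  rw [eval_eq', eval_eq', Finset.mul_sum]
  refine Finset.sum_congr rfl fun α hα => ?_
  have h2 : ∑ i, α i = d := by
    rw [← Finsupp.degree_eq_sum]
    exact (hF.degree_eq_sum_deg_support hα).symm
  simp only [Pi.smul_apply, smul_eq_mul, mul_pow, Finset.prod_mul_distrib,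
    Finset.prod_pow_eq_pow_sum, h2]
  ring

theorem eval_rep_mk_eq_zero_iff {F : MvPolynomial (Fin 3) k} {e : ℕ} (hF : F.IsHomogeneous e)
    {q : Fin 3 → k} (hq : q ≠ 0) :
    eval (Projectivization.mk k q hq).rep F = 0 ↔ eval q F = 0 := by
  obtain ⟨u, hu⟩ := Projectivization.exists_smul_eq_mk_rep k q hq
  rw [← hu, Units.smul_def, eval_smul_of_isHomogeneous hF, mul_eq_zero,
    or_iff_right (pow_ne_zero _ u.ne_zero)]

theorem vecMul_single_zero (M : Matrix (Fin 3) (Fin 3) k) :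
    Matrix.vecMul ![1, 0, 0] M = M 0 := by
  ext j
  simp [Matrix.vecMul, dotProduct, Fin.sum_univ_three]

/-- A generator becomes a form vanishing at `(1, 0, 0)`, so it has no pure power of `x₀`. -/
theorem frameSubst_mem_of_mem_pointIdeal {M : Matrix (Fin 3) (Fin 3) k} (hM : M 0 ≠ 0)
    {F : MvPolynomial (Fin 3) k} (hF : F ∈ pointIdeal (Projectivization.mk k (M 0) hM)) :
    frameSubst M F ∈ exponentIdeal k (fatExponents 1) := by
  suffices pointIdeal (Projectivization.mk k (M 0) hM) ≤
      (exponentIdeal k (fatExponents 1)).comap (frameSubst M) from this hF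
  refine Ideal.span_le.2 ?_
  rintro G ⟨⟨e, he⟩, hG⟩
  rw [eval_rep_mk_eq_zero_iff he, ← vecMul_single_zero M, ← eval_frameSubst] at hG
  have he' := isHomogeneous_frameSubst M he
  intro α hα
  have hα1 : α 1 = 0 := by rw [mem_fatExponents] at hα; omega
  have hα2 : α 2 = 0 := by rw [mem_fatExponents] at hα; omega
  by_contra hne
  have hdeg : α.degree = e := by
    by_contra h
    exact hne (he'.coeff_eq_zero h)
  rw [eval_eq', Finset.sum_eq_single α] at hG
  · simp [Fin.prod_univ_three, hα1, hα2] at hG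
    exact hne hG
  · intro β hβ hβα
    by_cases hz : β 1 = 0 ∧ β 2 = 0
    · refine absurd ?_ hβα
      have hβd : β.degree = e := he'.degree_eq_sum_deg_support hβ |>.symm
      rw [← hdeg, Finsupp.degree_eq_sum, Finsupp.degree_eq_sum, Fin.sum_univ_three,
        Fin.sum_univ_three] at hβd
      ext i
      fin_cases i <;> simp <;> omega
    · rw [Fin.prod_univ_three]
      rcases not_and_or.1 hz with h | h <;> simp [h]
  · intro h
    rw [notMem_support_iff.1 h, zero_mul]

theorem frameSubst_mem_of_mem_pointIdeal_pow {M : Matrix (Fin 3) (Fin 3) k} (hM : M 0 ≠ 0)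
    (m : ℕ) {F : MvPolynomial (Fin 3) k}
    (hF : F ∈ pointIdeal (Projectivization.mk k (M 0) hM) ^ m) :
    frameSubst M F ∈ exponentIdeal k (fatExponents m) := by
  induction m generalizing F with
  | zero =>
    intro α hα
    exact absurd (Nat.zero_le _) hα
  | succ m ih =>
    rw [pow_succ] at hF
    refine Submodule.mul_induction_on hF (fun G hG H hH => ?_) fun G H hG hH => ?_
    · rw [map_mul]
      exact mul_mem_exponentIdeal_fatExponents (ih hG) (frameSubst_mem_of_mem_pointIdeal hM hH)
    · rw [map_add]
      exact Ideal.add_mem _ hG hH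

theorem exists_frame_entry_ne_zero {M : Matrix (Fin 3) (Fin 3) k} (hM : M 0 ≠ 0) :
    ∃ i, M 0 i ≠ 0 := Function.ne_iff.1 hM

theorem frame_zero_ne_zero {N M : Matrix (Fin 3) (Fin 3) k} (h : M * N = 1) : M 0 ≠ 0 := by
  intro h0
  have := congrFun (congrFun h 0) 0
  simp [Matrix.mul_apply, h0] at this

/-- The fat point `mP` in terms of a frame whose first vector represents `P`. -/
theorem mem_fatPoint_iff {N M : Matrix (Fin 3) (Fin 3) k} (h : M * N = 1) (hM : M 0 ≠ 0) (m : ℕ)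
    (F : MvPolynomial (Fin 3) k) :
    F ∈ (fatPoint m (Projectivization.mk k (M 0) hM)).ideal ↔
      frameSubst M F ∈ exponentIdeal k (fatExponents m) := by
  constructor
  · intro hF
    -- In a chart containing the point, `x_i` becomes a linear form with nonzero `x₀`-coefficient,
    -- which can be cancelled modulo the monomial ideal.
    obtain ⟨i, hi⟩ := exists_frame_entry_ne_zero hM
    obtain ⟨n, hn⟩ := hF i
    have h1 := frameSubst_mem_of_mem_pointIdeal_pow hM m hn
    rw [map_mul, map_pow, frameSubst_X] at h1
    refine mem_exponentIdeal_of_linear_pow_mul_mem (fun α hα => ?_) hi n h1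
    simpa [mem_fatExponents] using hα
  · intro hF i
    -- The power of the point ideal is already saturated, so exponent zero works in every chart.
    refine ⟨0, ?_⟩
    rw [pow_zero, one_mul]
    have hgen : ∀ j : Fin 3, j ≠ 0 →
        frameSubst N (X j) ∈ pointIdeal (Projectivization.mk k (M 0) hM) := by
      intro j hj
      have hh : (frameSubst N (X j : MvPolynomial (Fin 3) k)).IsHomogeneous 1 :=
        isHomogeneous_frameSubst N (isHomogeneous_X _ j)
      refine Ideal.subset_span ⟨⟨1, hh⟩, ?_⟩
      rw [eval_rep_mk_eq_zero_iff hh, eval_frameSubst, eval_X]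
      have h2 := congrFun (congrFun h 0) j
      rwa [Matrix.one_apply_ne hj.symm, Matrix.mul_apply_eq_vecMul] at h2
    rw [← frameSubst_of_mul_eq_one (mul_eq_one_comm.1 h) F,
      (frameSubst M F).as_sum, map_sum]
    refine Ideal.sum_mem _ fun α hα => ?_
    have hα' : m ≤ α 1 + α 2 := by
      by_contra hlt
      exact mem_support_iff.1 hα (hF α hlt)
    rw [monomial_eq, map_mul, Finsupp.prod_fintype _ _ (by simp), map_prod, Fin.prod_univ_three,
      mul_assoc, map_pow, map_pow, map_pow]
    refine Ideal.mul_mem_left _ _ (Ideal.mul_mem_left _ _ (Ideal.pow_le_pow_right hα' ?_))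
    rw [pow_add]
    exact Ideal.mul_mem_mul (Ideal.pow_mem_pow (hgen 1 (by decide)) _)
      (Ideal.pow_mem_pow (hgen 2 (by decide)) _)

end FatPoint

/-! ### Dimension counts for monomial conditions -/

section Dimension

variable {k : Type*} [Field k]

instance finite_homogeneousSubmodule (d : ℕ) :
    Module.Finite k (homogeneousSubmodule (Fin 3) k d) :=
  Module.Finite.of_fg (homogeneousSubmodule_fg _ _ d)

theorem finrank_inf_ker_add_finrank_range {E E' : Type*} [AddCommGroup E] [Module k E]
    [AddCommGroup E'] [Module k E'] (W : Submodule k E) [Module.Finite k W] (φ : E →ₗ[k] E') :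
    Module.finrank k (W ⊓ LinearMap.ker φ : Submodule k E) +
      Module.finrank k (LinearMap.range (φ.domRestrict W)) = Module.finrank k W := by
  rw [← LinearMap.finrank_range_add_finrank_ker (φ.domRestrict W), add_comm]
  congr 1
  have h : (LinearMap.ker (φ.domRestrict W)).map W.subtype = W ⊓ LinearMap.ker φ := by
    rw [LinearMap.ker_domRestrict, Submodule.map_comap_subtype]
  rw [← h]
  exact Submodule.finrank_map_subtype_eq _ _

/-- The coefficients of `F`, written in the coordinates of the frame `M`, at the exponents in
`S`. -/
noncomputable def frameCoeffs {ι : Type*} (M : Matrix (Fin 3) (Fin 3) k) (S : ι → Fin 3 →₀ ℕ) :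
    MvPolynomial (Fin 3) k →ₗ[k] ι → k :=
  LinearMap.pi fun i => lcoeff k (S i) ∘ₗ (frameSubst M).toLinearMap

theorem frameCoeffs_apply {ι : Type*} (M : Matrix (Fin 3) (Fin 3) k) (S : ι → Fin 3 →₀ ℕ)
    (F : MvPolynomial (Fin 3) k) (i : ι) :
    frameCoeffs M S F i = coeff (S i) (frameSubst M F) := rfl

theorem range_frameCoeffs {N M : Matrix (Fin 3) (Fin 3) k} (h : M * N = 1) {d : ℕ}
    (S : Finset (Fin 3 →₀ ℕ)) (hS : ∀ α ∈ S, α.degree = d) :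
    LinearMap.range ((frameCoeffs M (fun α : S => (α : Fin 3 →₀ ℕ))).domRestrict
      (homogeneousSubmodule (Fin 3) k d)) = ⊤ := by
  rw [LinearMap.range_eq_top]
  intro y
  have hG : (∑ α : S, monomial (α : Fin 3 →₀ ℕ) (y α)).IsHomogeneous d :=
    IsHomogeneous.sum _ _ _ fun α _ => isHomogeneous_monomial _ (hS α α.2)
  refine ⟨⟨frameSubst N (∑ α : S, monomial (α : Fin 3 →₀ ℕ) (y α)),
    isHomogeneous_frameSubst N hG⟩, ?_⟩
  ext β
  rw [LinearMap.domRestrict_apply, frameCoeffs_apply, frameSubst_of_mul_eq_one h, coeff_sum,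
    Finset.sum_eq_single β]
  · rw [coeff_monomial, if_pos rfl]
  · intro α _ hα
    rw [coeff_monomial, if_neg]
    exact fun h => hα (Subtype.ext h)
  · simp

theorem finrank_inf_ker_frameCoeffs {N M : Matrix (Fin 3) (Fin 3) k} (h : M * N = 1) {d : ℕ}
    (S : Finset (Fin 3 →₀ ℕ)) (hS : ∀ α ∈ S, α.degree = d) :
    Module.finrank k (homogeneousSubmodule (Fin 3) k d ⊓
      LinearMap.ker (frameCoeffs M (fun α : S => (α : Fin 3 →₀ ℕ))) :
        Submodule k (MvPolynomial (Fin 3) k)) + S.card =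
      Module.finrank k (homogeneousSubmodule (Fin 3) k d) := by
  rw [← finrank_inf_ker_add_finrank_range (homogeneousSubmodule (Fin 3) k d)
    (frameCoeffs M (fun α : S => (α : Fin 3 →₀ ℕ))), range_frameCoeffs h S hS]
  simp

theorem mem_finsuppAntidiag_univ {d : ℕ} {α : Fin 3 →₀ ℕ} :
    α ∈ Finset.finsuppAntidiag Finset.univ d ↔ α.degree = d := by
  simp [Finset.mem_finsuppAntidiag, Finsupp.degree_eq_sum]

theorem degree_eq_add (α : Fin 3 →₀ ℕ) : α.degree = α 0 + α 1 + α 2 := by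
  rw [Finsupp.degree_eq_sum, Fin.sum_univ_three]

open Classical in
/-- The exponents of degree `d` that do not lie in `T`. -/
noncomputable def residualExponents (T : UpperSet (Fin 3 →₀ ℕ)) (d : ℕ) :
    Finset (Fin 3 →₀ ℕ) :=
  {α ∈ Finset.finsuppAntidiag Finset.univ d | α ∉ T}

theorem mem_residualExponents {T : UpperSet (Fin 3 →₀ ℕ)} {d : ℕ} {α : Fin 3 →₀ ℕ} :
    α ∈ residualExponents T d ↔ α.degree = d ∧ α ∉ T := by
  simp only [residualExponents, Finset.mem_filter, mem_finsuppAntidiag_univ]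

theorem homogeneous_mem_exponentIdeal_iff {T : UpperSet (Fin 3 →₀ ℕ)} {d : ℕ}
    {G : MvPolynomial (Fin 3) k} (hG : G.IsHomogeneous d) :
    G ∈ exponentIdeal k T ↔ ∀ α ∈ residualExponents T d, coeff α G = 0 := by
  constructor
  · exact fun h α hα => h α (mem_residualExponents.1 hα).2
  · intro h α hα
    by_cases hd : α.degree = d
    · exact h α (mem_residualExponents.2 ⟨hd, hα⟩)
    · exact hG.coeff_eq_zero hd

/-- The forms of degree `d` that lie in the monomial ideal of `T` in the coordinates of `M`. -/
theorem finrank_inf_comap_exponentIdeal {N M : Matrix (Fin 3) (Fin 3) k} (h : M * N = 1)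
    (T : UpperSet (Fin 3 →₀ ℕ)) (d : ℕ) :
    Module.finrank k (homogeneousSubmodule (Fin 3) k d ⊓
      ((exponentIdeal k T).comap (frameSubst M)).restrictScalars k :
        Submodule k (MvPolynomial (Fin 3) k)) + (residualExponents T d).card =
      Module.finrank k (homogeneousSubmodule (Fin 3) k d) := by
  rw [← finrank_inf_ker_frameCoeffs h (residualExponents T d)
    fun α hα => (mem_residualExponents.1 hα).1]
  suffices heq : (homogeneousSubmodule (Fin 3) k d ⊓
      ((exponentIdeal k T).comap (frameSubst M)).restrictScalars k :
        Submodule k (MvPolynomial (Fin 3) k)) = homogeneousSubmodule (Fin 3) k d ⊓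
          LinearMap.ker (frameCoeffs M fun α : residualExponents T d => (α : Fin 3 →₀ ℕ)) by
    rw [heq]
  ext F
  refine and_congr_right fun hF => ?_
  refine (homogeneous_mem_exponentIdeal_iff (isHomogeneous_frameSubst M hF)).trans ?_
  rw [SetLike.mem_coe, LinearMap.mem_ker, funext_iff, Subtype.forall]
  rfl

theorem finrank_homogeneousSubmodule (d : ℕ) :
    Module.finrank k (homogeneousSubmodule (Fin 3) k d) = (d + 2).choose 2 := by
  -- Upper sets are ordered by reverse inclusion: `⊤` is the empty set of exponents, whose ideal is
  -- zero, and all monomials of degree `d` are counted.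
  rw [← finrank_inf_comap_exponentIdeal (one_mul (1 : Matrix (Fin 3) (Fin 3) k)) ⊤ d]
  have h : (homogeneousSubmodule (Fin 3) k d ⊓
      ((exponentIdeal k ⊤).comap (frameSubst 1)).restrictScalars k :
        Submodule k (MvPolynomial (Fin 3) k)) = ⊥ := by
    rw [eq_bot_iff]
    rintro F ⟨-, hF⟩
    change frameSubst 1 F ∈ exponentIdeal k ⊤ at hF
    rw [frameSubst_one] at hF
    rw [Submodule.mem_bot]
    ext α
    exact hF α UpperSet.notMem_top
  have h2 : residualExponents ⊤ d = Finset.finsuppAntidiag Finset.univ d := by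
    ext α
    rw [mem_residualExponents, mem_finsuppAntidiag_univ, and_iff_left UpperSet.notMem_top]
  rw [h, h2, finrank_bot, zero_add, Finset.card_finsuppAntidiag_nat_eq_choose, Finset.card_univ,
    Fintype.card_fin, Nat.choose_symm_of_eq_add (b := 2) (by omega)]
  congr 1
  omega

/-- The exponent of `x₀ᵃ x₁ᵇ x₂ᶜ`. -/
noncomputable def exponent (a b c : ℕ) : Fin 3 →₀ ℕ := Finsupp.equivFunOnFinite.symm ![a, b, c]

@[simp] theorem exponent_zero (a b c : ℕ) : exponent a b c 0 = a := rfl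

@[simp] theorem exponent_one (a b c : ℕ) : exponent a b c 1 = b := rfl

@[simp] theorem exponent_two (a b c : ℕ) : exponent a b c 2 = c := rfl

theorem eq_exponent_iff {α : Fin 3 →₀ ℕ} {a b c : ℕ} :
    α = exponent a b c ↔ α 0 = a ∧ α 1 = b ∧ α 2 = c := by
  constructor
  · rintro rfl
    exact ⟨rfl, rfl, rfl⟩
  · rintro ⟨rfl, rfl, rfl⟩
    ext i
    fin_cases i <;> rfl

/-- In degree zero only the constant monomial is left, one condition instead of two; hence the bound
on `e`. -/
theorem residualExponents_dotExponents {e : ℕ} (he : 1 ≤ e) :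
    residualExponents dotExponents e = {exponent e 0 0, exponent (e - 1) 1 0} := by
  ext α
  rw [mem_residualExponents, mem_dotExponents, degree_eq_add, Finset.mem_insert,
    Finset.mem_singleton, eq_exponent_iff, eq_exponent_iff]
  omega

theorem card_residualExponents_dotExponents {e : ℕ} (he : 1 ≤ e) :
    (residualExponents dotExponents e).card = 2 := by
  rw [residualExponents_dotExponents he, Finset.card_pair]
  intro h
  have := DFunLike.congr_fun h 1
  simp at this

end Dimension

/-! ### 2-dots in an adapted frame -/

section Dot

variable {k : Type*} [Field k] {N M : Matrix (Fin 3) (Fin 3) k}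

theorem frameSubst_linear (M : Matrix (Fin 3) (Fin 3) k) (a : Fin 3 → k) :
    frameSubst M (∑ j, C (a j) * X j) = ∑ i, C (M.mulVec a i) * X i := by
  simp only [Fin.sum_univ_three, map_add, map_mul, frameSubst_X, frameSubst_C, Matrix.mulVec,
    dotProduct]
  ring

theorem hilbertFunction_add (Z : ClosedSubscheme k 2) (e : ℕ) :
    hilbertFunction Z e + (Module.finrank k (homogeneousSubmodule (Fin 3) k e ⊓
      Z.ideal.restrictScalars k : Submodule k (MvPolynomial (Fin 3) k)) : ℕ) =
        (Module.finrank k (homogeneousSubmodule (Fin 3) k e) : ℕ) :=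
  sub_add_cancel _ _

theorem mem_of_forall_homogeneousComponent_mem {I : Ideal (MvPolynomial (Fin 3) k)}
    {F : MvPolynomial (Fin 3) k} (h : ∀ j, homogeneousComponent j F ∈ I) : F ∈ I := by
  rw [← sum_homogeneousComponent F]
  exact Ideal.sum_mem _ fun j _ => h j

theorem mem_of_forall_monomial_mem {I : Ideal (MvPolynomial (Fin 3) k)}
    {T : UpperSet (Fin 3 →₀ ℕ)} (h : ∀ α ∈ T, ∀ r : k, monomial α r ∈ I)
    {F : MvPolynomial (Fin 3) k} (hF : F ∈ exponentIdeal k T) : F ∈ I := by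
  rw [F.as_sum]
  refine Ideal.sum_mem _ fun α hα => h α ?_ _
  by_contra hα'
  exact mem_support_iff.1 hα (hF α hα')

theorem exponentIdeal_fatExponents_le_comap (h : M * N = 1) (hM : M 0 ≠ 0) {m : ℕ}
    {Z : ClosedSubscheme k 2} (hZ : IsSubscheme Z (fatPoint m (Projectivization.mk k (M 0) hM))) :
    exponentIdeal k (fatExponents m) ≤ Z.ideal.comap (frameSubst N) := by
  intro G hG
  refine hZ ((mem_fatPoint_iff h hM m _).2 ?_)
  rwa [frameSubst_of_mul_eq_one h]

theorem mem_comap_frameSubst_iff (h : M * N = 1) {I : Ideal (MvPolynomial (Fin 3) k)}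
    {F : MvPolynomial (Fin 3) k} : frameSubst M F ∈ I.comap (frameSubst N) ↔ F ∈ I := by
  rw [Ideal.mem_comap, frameSubst_of_mul_eq_one (mul_eq_one_comm.1 h)]

/-- A line containing a 2-dot passes through its support. -/
theorem mulVec_zero_of_linear_mem (h : M * N = 1) (hM : M 0 ≠ 0) {Z : ClosedSubscheme k 2}
    (hZ : IsSubscheme Z (fatPoint 2 (Projectivization.mk k (M 0) hM))) (hl : HasLength Z 2)
    {a : Fin 3 → k} (ha : ∑ j, C (a j) * X j ∈ Z.ideal) : M.mulVec a 0 = 0 := by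
  by_contra h0a
  have hfat := exponentIdeal_fatExponents_le_comap h hM hZ
  rw [← mem_comap_frameSubst_iff h, frameSubst_linear] at ha
  -- If the line missed the support, `x₀` could be traded for `x₁` and `x₂` modulo the ideal until a
  -- monomial of degree at least 2 lies in `(x₁, x₂)²`. All forms of large degree would then be in
  -- the ideal, contradicting length 2.
  have key : ∀ n : ℕ, ∀ α : Fin 3 →₀ ℕ, α 0 = n → 2 ≤ α.degree → ∀ r : k,
      monomial α r ∈ Z.ideal.comap (frameSubst N) := by
    intro n
    induction n with
    | zero =>
      intro α hα hd r
      refine hfat (monomial_mem_exponentIdeal ?_ r)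
      rw [degree_eq_add] at hd
      rw [mem_fatExponents]
      omega
    | succ n ih =>
      intro α hα hd r
      obtain ⟨β, rfl⟩ : ∃ β, α = β + Finsupp.single 0 1 := by
        refine ⟨α - Finsupp.single 0 1, (tsub_add_cancel_of_le ?_).symm⟩
        rw [Finsupp.single_le_iff]
        omega
      have hβ : β 0 = n := by simpa using hα
      have hdβ : 2 ≤ β.degree + 1 := by simpa using hd
      have h1 := Ideal.mul_mem_left _ (monomial β (r * (M.mulVec a 0)⁻¹)) ha
      have h2 : ∀ i : Fin 3, monomial β (r * (M.mulVec a 0)⁻¹) * (C (M.mulVec a i) * X i) =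
          monomial (β + Finsupp.single i 1) (r * (M.mulVec a 0)⁻¹ * M.mulVec a i) := by
        intro i
        rw [C_mul_X_eq_monomial, monomial_mul]
      rw [Fin.sum_univ_three, mul_add, mul_add, h2, h2, h2, inv_mul_cancel_right₀ h0a,
        add_assoc] at h1
      refine (Ideal.add_mem_iff_left _ (Ideal.add_mem _ ?_ ?_)).1 h1 <;>
      exact ih _ (by simpa) (by simpa using hdβ) _
  obtain ⟨e₀, he₀⟩ := hl
  have h1 := he₀ (max e₀ 2) (le_max_left _ _)
  have h2 := hilbertFunction_add Z (max e₀ 2)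
  have h3 : homogeneousSubmodule (Fin 3) k (max e₀ 2) ⊓ Z.ideal.restrictScalars k =
      homogeneousSubmodule (Fin 3) k (max e₀ 2) := by
    refine inf_eq_left.2 fun F hF => ?_
    rw [Submodule.restrictScalars_mem, ← mem_comap_frameSubst_iff h, (frameSubst M F).as_sum]
    refine Ideal.sum_mem _ fun α hα => key _ α rfl ?_ _
    exact (le_max_right e₀ 2).trans_eq
      ((isHomogeneous_frameSubst M hF).degree_eq_sum_deg_support hα)
  rw [h3] at h2
  omega

theorem dotExponents_of_add_single {α : Fin 3 →₀ ℕ}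
    (h : α + Finsupp.single 0 1 ∈ dotExponents) : α ∈ dotExponents := by
  simpa [mem_dotExponents] using h

theorem finrank_inf_comap_exponentIdeal_dotExponents (h : M * N = 1) {e : ℕ} (he : 1 ≤ e) :
    Module.finrank k (homogeneousSubmodule (Fin 3) k e ⊓
      ((exponentIdeal k dotExponents).comap (frameSubst M)).restrictScalars k :
        Submodule k (MvPolynomial (Fin 3) k)) + 2 =
      Module.finrank k (homogeneousSubmodule (Fin 3) k e) := by
  rw [← finrank_inf_comap_exponentIdeal h dotExponents e, card_residualExponents_dotExponents he]

/-- A 2-dot in terms of a frame whose first two vectors span the line of the dot, the first one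
representing its support. -/
theorem mem_dot_iff (h : M * N = 1) (hM : M 0 ≠ 0) {Z : ClosedSubscheme k 2}
    (hZ : IsSubscheme Z (fatPoint 2 (Projectivization.mk k (M 0) hM))) (hl : HasLength Z 2)
    {a : Fin 3 → k} (ha0 : a ≠ 0) (ha : ∑ j, C (a j) * X j ∈ Z.ideal) (ha1 : M.mulVec a 1 = 0)
    (F : MvPolynomial (Fin 3) k) :
    F ∈ Z.ideal ↔ frameSubst M F ∈ exponentIdeal k dotExponents := by
  have hfat := exponentIdeal_fatExponents_le_comap h hM hZ
  have hM0 := mulVec_zero_of_linear_mem h hM hZ hl ha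
  have ha2 : M.mulVec a 2 ≠ 0 := by
    intro h2
    refine ha0 ?_
    have : M.mulVec a = 0 := by
      ext i
      fin_cases i <;> assumption
    rw [← Matrix.one_mulVec a, ← mul_eq_one_comm.1 h, ← Matrix.mulVec_mulVec, this,
      Matrix.mulVec_zero]
  have hX2 : (X 2 : MvPolynomial (Fin 3) k) ∈ Z.ideal.comap (frameSubst N) := by
    rw [← mem_comap_frameSubst_iff h, frameSubst_linear, Fin.sum_univ_three, hM0, ha1] at ha
    have h1 := Ideal.mul_mem_left _ (C (M.mulVec a 2)⁻¹) ha
    rwa [map_zero, zero_mul, zero_mul, zero_add, zero_add, ← mul_assoc, ← C_mul,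
      inv_mul_cancel₀ ha2, map_one, one_mul] at h1
  have hle : ∀ G ∈ exponentIdeal k dotExponents, G ∈ Z.ideal.comap (frameSubst N) := by
    refine fun G hG => mem_of_forall_monomial_mem (fun α hα r => ?_) hG
    rcases hα with hα | hα
    · refine hfat (monomial_mem_exponentIdeal ?_ r)
      rw [mem_fatExponents]
      omega
    · have h1 : monomial α r = monomial (α - Finsupp.single 2 1) r * X 2 := by
        rw [X, monomial_mul, mul_one, tsub_add_cancel_of_le]
        rwa [Finsupp.single_le_iff]
      rw [h1]
      exact Ideal.mul_mem_left _ _ hX2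
  have hle' : ∀ G, frameSubst M G ∈ exponentIdeal k dotExponents → G ∈ Z.ideal :=
    fun G hG => (mem_comap_frameSubst_iff h).1 (hle _ hG)
  refine ⟨fun hF => ?_, hle' F⟩
  obtain ⟨e₀, he₀⟩ := hl
  -- One inclusion is known, and in large degrees both ideals have codimension two, so they agree
  -- there.
  have heq : ∀ e ≥ max e₀ 1, homogeneousSubmodule (Fin 3) k e ⊓
      ((exponentIdeal k dotExponents).comap (frameSubst M)).restrictScalars k =
        homogeneousSubmodule (Fin 3) k e ⊓ Z.ideal.restrictScalars k := by
    intro e he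
    have hfin : Module.Finite k (homogeneousSubmodule (Fin 3) k e ⊓ Z.ideal.restrictScalars k :
        Submodule k (MvPolynomial (Fin 3) k)) := Submodule.finiteDimensional_inf_left _ _
    refine Submodule.eq_of_le_of_finrank_eq (inf_le_inf_left _ hle') ?_
    have h1 := he₀ e ((le_max_left _ _).trans he)
    have h2 := hilbertFunction_add Z e
    have h3 := finrank_inf_comap_exponentIdeal_dotExponents h ((le_max_right _ _).trans he)
    omega
  change F ∈ (exponentIdeal k dotExponents).comap (frameSubst M)
  refine mem_of_forall_homogeneousComponent_mem fun j => ?_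
  obtain ⟨i, hi⟩ := exists_frame_entry_ne_zero hM
  -- Low degrees are reached by multiplying by a power of `x_i` and cancelling it in the frame.
  have h1 : X i ^ (max e₀ 1) * homogeneousComponent j F ∈
      homogeneousSubmodule (Fin 3) k (max e₀ 1 + j) ⊓ Z.ideal.restrictScalars k :=
    ⟨(isHomogeneous_X_pow i _).mul (homogeneousComponent_isHomogeneous j F),
      Ideal.mul_mem_left _ _ (Z.homogeneous F hF j)⟩
  rw [← heq _ (Nat.le_add_right _ _)] at h1
  have h2 : frameSubst M (X i ^ (max e₀ 1) * homogeneousComponent j F) ∈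
    exponentIdeal k dotExponents := h1.2
  rw [map_mul, map_pow, frameSubst_X] at h2
  exact mem_exponentIdeal_of_linear_pow_mul_mem (fun α => dotExponents_of_add_single) hi _ h2

/-- The 2-dot supported at the point represented by `M 0` on the line spanned by `M 0` and
`M 1`. -/
noncomputable def frameDot (M : Matrix (Fin 3) (Fin 3) k) (hM : M 0 ≠ 0) : ClosedSubscheme k 2 where
  ideal := (exponentIdeal k dotExponents).comap (frameSubst M)
  homogeneous := by
    intro F hF j
    rw [Ideal.mem_comap, ← homogeneousComponent_frameSubst]
    exact homogeneousComponent_mem_exponentIdeal hF j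
  saturated := by
    intro F hF
    obtain ⟨i, hi⟩ := exists_frame_entry_ne_zero hM
    obtain ⟨n, hn⟩ := hF i
    rw [Ideal.mem_comap, map_mul, map_pow, frameSubst_X] at hn
    exact mem_exponentIdeal_of_linear_pow_mul_mem (fun α => dotExponents_of_add_single) hi _ hn

theorem isSubscheme_frameDot (h : M * N = 1) (hM : M 0 ≠ 0) :
    IsSubscheme (frameDot M hM) (fatPoint 2 (Projectivization.mk k (M 0) hM)) := by
  intro F hF α hα
  refine (mem_fatPoint_iff h hM 2 F).1 hF α fun hα' => hα ?_
  rw [mem_fatExponents] at hα'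
  rw [mem_dotExponents]
  omega

theorem isDot_frameDot (h : M * N = 1) (hM : M 0 ≠ 0) : IsDot 2 (frameDot M hM) := by
  refine ⟨⟨_, isSubscheme_frameDot h hM⟩, 1, fun e he => ?_⟩
  have h1 := hilbertFunction_add (frameDot M hM) e
  have h2 := finrank_inf_comap_exponentIdeal_dotExponents h he
  change _ + ((Module.finrank k (homogeneousSubmodule (Fin 3) k e ⊓
      ((exponentIdeal k dotExponents).comap (frameSubst M)).restrictScalars k :
        Submodule k (MvPolynomial (Fin 3) k)) : ℕ) : ℤ) = _ at h1
  omega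

theorem linear_mem_frameDot (hM : M 0 ≠ 0) {a : Fin 3 → k} (ha0 : M.mulVec a 0 = 0)
    (ha1 : M.mulVec a 1 = 0) : ∑ j, C (a j) * X j ∈ (frameDot M hM).ideal := by
  change frameSubst M _ ∈ exponentIdeal k dotExponents
  rw [frameSubst_linear, Fin.sum_univ_three, ha0, ha1, map_zero, zero_mul, zero_mul, zero_add,
    zero_add, C_mul_X_eq_monomial]
  exact monomial_mem_exponentIdeal (by simp [mem_dotExponents]) _

end Dot

/-! ### Restriction to lines and the Wronskian argument -/

section Line

variable {k : Type*} [Field k]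

/-- The restriction of `F` to the parametrized line `q + t v`. -/
noncomputable def lineRestriction (q v : Fin 3 → k) :
    MvPolynomial (Fin 3) k →ₐ[k] Polynomial k :=
  aeval fun j => Polynomial.C (q j) + Polynomial.C (v j) * Polynomial.X

theorem eval_lineRestriction (q v : Fin 3 → k) (F : MvPolynomial (Fin 3) k) (t : k) :
    (lineRestriction q v F).eval t = eval (q + t • v) F := by
  have : (Polynomial.aeval t).comp (lineRestriction q v) = aeval (q + t • v) := by
    refine algHom_ext fun j => ?_
    simp [lineRestriction, mul_comm t]
  simpa [aeval_eq_eval, Polynomial.coe_aeval_eq_eval] using DFunLike.congr_fun this F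

/-- Moving the base point along the line is a Taylor shift, so the jets at all points of a line are
read off from one polynomial. -/
theorem taylor_lineRestriction (q v : Fin 3 → k) (F : MvPolynomial (Fin 3) k) (t : k) :
    Polynomial.taylor t (lineRestriction q v F) = lineRestriction (q + t • v) v F := by
  have : (Polynomial.taylorAlgHom t).comp (lineRestriction q v) =
      lineRestriction (q + t • v) v := by
    refine algHom_ext fun j => ?_
    simp [lineRestriction]
    ring
  simpa using DFunLike.congr_fun this F

theorem aeval_frameSubst_eq_lineRestriction (M : Matrix (Fin 3) (Fin 3) k)
    (F : MvPolynomial (Fin 3) k) :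
    aeval ![1, Polynomial.X, 0] (frameSubst M F) = lineRestriction (M 0) (M 1) F := by
  have : (aeval ![1, Polynomial.X, 0]).comp (frameSubst M) = lineRestriction (M 0) (M 1) := by
    refine algHom_ext fun j => ?_
    simp [lineRestriction, frameSubst_X, Fin.sum_univ_three, Polynomial.C_eq_algebraMap]
  exact DFunLike.congr_fun this F

/-- The conditions imposed by a 2-dot: the value and the derivative along a line. -/
noncomputable def firstOrderJet (q v : Fin 3 → k) : MvPolynomial (Fin 3) k →ₗ[k] Fin 2 → k :=
  LinearMap.pi ![Polynomial.lcoeff k 0 ∘ₗ (lineRestriction q v).toLinearMap,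
    Polynomial.lcoeff k 1 ∘ₗ (lineRestriction q v).toLinearMap]

theorem firstOrderJet_zero (q v : Fin 3 → k) (F : MvPolynomial (Fin 3) k) :
    firstOrderJet q v F 0 = (lineRestriction q v F).coeff 0 := rfl

theorem firstOrderJet_one (q v : Fin 3 → k) (F : MvPolynomial (Fin 3) k) :
    firstOrderJet q v F 1 = (lineRestriction q v F).coeff 1 := rfl

/-- The parametrization `(1, t, 0)` of the line of the dot sends `(x₁², x₂)` into `(t²)`. -/
theorem firstOrderJet_eq_zero {M : Matrix (Fin 3) (Fin 3) k} {F : MvPolynomial (Fin 3) k}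
    (hF : frameSubst M F ∈ exponentIdeal k dotExponents) : firstOrderJet (M 0) (M 1) F = 0 := by
  have h : Polynomial.X ^ 2 ∣ lineRestriction (M 0) (M 1) F := by
    rw [← aeval_frameSubst_eq_lineRestriction, ← Ideal.mem_span_singleton]
    change frameSubst M F ∈ (Ideal.span {Polynomial.X ^ 2}).comap
      (aeval (R := k) ![1, (Polynomial.X : Polynomial k), 0])
    refine mem_of_forall_monomial_mem (fun α hα r => ?_) hF
    rw [Ideal.mem_comap, Ideal.mem_span_singleton, aeval_monomial,
      Finsupp.prod_fintype _ _ (by simp), Fin.prod_univ_three]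
    refine Dvd.dvd.mul_left ?_ _
    rcases hα with hα | hα
    · refine Dvd.dvd.mul_right (Dvd.dvd.mul_left ?_ _) _
      exact pow_dvd_pow _ hα
    · refine Dvd.dvd.mul_left ?_ _
      simp [zero_pow (Nat.one_le_iff_ne_zero.1 hα)]
  rw [Polynomial.X_pow_dvd_iff] at h
  ext i
  fin_cases i
  · exact h 0 (by norm_num)
  · exact h 1 (by norm_num)

/-- Completing `q`, `v` by the `i`-th unit vector gives a matrix whose determinant is the `i`-th
entry of the cross product. -/
theorem exists_frame_of_crossProduct_ne_zero {q v : Fin 3 → k} (h : crossProduct q v ≠ 0) :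
    ∃ M N : Matrix (Fin 3) (Fin 3) k, M * N = 1 ∧ M 0 = q ∧ M 1 = v := by
  obtain ⟨i, hi⟩ := Function.ne_iff.1 h
  let M : Matrix (Fin 3) (Fin 3) k := Matrix.of ![q, v, Pi.single i 1]
  have hdet : M.det = crossProduct q v i := by
    simp only [M, Matrix.det_fin_three, cross_apply]
    fin_cases i
    · simp
    · simp
      ring
    · simp
  exact ⟨M, M⁻¹, Matrix.mul_nonsing_inv _ (isUnit_iff_ne_zero.2 (hdet ▸ hi)), rfl, rfl⟩

theorem exists_frame_of_ne_zero {q : Fin 3 → k} (h : q ≠ 0) :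
    ∃ M N : Matrix (Fin 3) (Fin 3) k, M * N = 1 ∧ M 0 = q := by
  obtain ⟨v, hv⟩ : ∃ v, crossProduct q v ≠ 0 := by
    by_contra! hq
    refine h ?_
    have h0 := hq (Pi.single 0 1)
    have h1 := hq (Pi.single 1 1)
    simp only [cross_apply] at h0 h1
    ext i
    fin_cases i
    · simpa using congrFun h1 2
    · simpa using congrFun h0 2
    · simpa using congrFun h0 1
  obtain ⟨M, N, hMN, hM, -⟩ := exists_frame_of_crossProduct_ne_zero hv
  exact ⟨M, N, hMN, hM⟩

theorem finrank_inf_comap_dot_add_le (M : Matrix (Fin 3) (Fin 3) k)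
    (V : Submodule k (MvPolynomial (Fin 3) k)) [Module.Finite k V] :
    Module.finrank k (V ⊓ ((exponentIdeal k dotExponents).comap (frameSubst M)).restrictScalars k :
      Submodule k (MvPolynomial (Fin 3) k)) +
      Module.finrank k (LinearMap.range ((firstOrderJet (M 0) (M 1)).domRestrict V)) ≤
        Module.finrank k V := by
  rw [← finrank_inf_ker_add_finrank_range V (firstOrderJet (M 0) (M 1))]
  have : Module.Finite k (V ⊓ LinearMap.ker (firstOrderJet (M 0) (M 1)) :
    Submodule k (MvPolynomial (Fin 3) k)) := Submodule.finiteDimensional_inf_left _ _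
  exact Nat.add_le_add_right (Submodule.finrank_mono
    (inf_le_inf_left _ fun F hF => firstOrderJet_eq_zero hF)) _

variable [CharZero k]

/-- Were the two products equal, their orders of vanishing at 0 would be `ord g - 1` on the left and
at least `ord g` on the right. -/
theorem mul_derivative_sub_ne_zero {f g : Polynomial k} (hf : f.eval 0 ≠ 0) (hg : g.eval 0 = 0)
    (hg0 : g ≠ 0) :
    f * Polynomial.derivative g - g * Polynomial.derivative f ≠ 0 := by
  intro h
  have h := sub_eq_zero.1 h
  have hroot : g.IsRoot 0 := hg
  have hf0 : f ≠ 0 := by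
    rintro rfl
    simp at hf
  have hpos : 0 < g.rootMultiplicity 0 := (Polynomial.rootMultiplicity_pos hg0).2 hroot
  have hg' : Polynomial.derivative g ≠ 0 := by
    intro h'
    rw [Polynomial.eq_C_of_derivative_eq_zero h'] at hg hg0
    rw [Polynomial.eval_C] at hg
    rw [hg, map_zero] at hg0
    exact hg0 rfl
  have h1 := Polynomial.rootMultiplicity_mul (x := 0) (mul_ne_zero hf0 hg')
  rw [Polynomial.rootMultiplicity_eq_zero (p := f) (x := 0) hf,
    Polynomial.derivative_rootMultiplicity_of_root hroot, h,
    Polynomial.rootMultiplicity_mul (h ▸ mul_ne_zero hf0 hg')] at h1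
  omega

/-- Two linearly independent forms are separated by the first order jet of some line. -/
theorem exists_jet_det_ne_zero {F G : MvPolynomial (Fin 3) k}
    (hFG : LinearIndependent k ![F, G]) :
    ∃ q v : Fin 3 → k, firstOrderJet q v F 0 * firstOrderJet q v G 1 -
      firstOrderJet q v G 0 * firstOrderJet q v F 1 ≠ 0 := by
  have hF : F ≠ 0 := hFG.ne_zero 0
  obtain ⟨q₀, hq₀⟩ : ∃ q, eval q F ≠ 0 := by
    by_contra! h
    exact hF (MvPolynomial.funext fun q => by rw [h q, map_zero])
  -- With this `r`, `G - rF` vanishes at `q₀` while `F` does not. The line will join `q₀` to a point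
  -- where `G - rF` is nonzero.
  set r := eval q₀ G / eval q₀ F with hr
  have hH : G - C r * F ≠ 0 := by
    intro h
    rw [LinearIndependent.pair_iff] at hFG
    have := (hFG (-r) 1 (by rw [one_smul, neg_smul, smul_eq_C_mul, ← h]; ring)).2
    exact one_ne_zero this
  obtain ⟨q₁, hq₁⟩ : ∃ q, eval q (G - C r * F) ≠ 0 := by
    by_contra! h
    exact hH (MvPolynomial.funext fun q => by rw [h q, map_zero])
  set v := q₁ - q₀ with hv
  have h1 : (lineRestriction q₀ v F).eval 0 ≠ 0 := by
    rwa [eval_lineRestriction, zero_smul, add_zero]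
  have h2 : (lineRestriction q₀ v (G - C r * F)).eval 0 = 0 := by
    rw [eval_lineRestriction, zero_smul, add_zero, map_sub, map_mul, eval_C, hr,
      div_mul_cancel₀ _ hq₀, sub_self]
  have h3 : lineRestriction q₀ v (G - C r * F) ≠ 0 := by
    intro h
    refine hq₁ ?_
    have := eval_lineRestriction q₀ v (G - C r * F) 1
    rwa [h, one_smul, hv, add_sub_cancel, Polynomial.eval_zero, eq_comm] at this
  obtain ⟨t, ht⟩ : ∃ t, (lineRestriction q₀ v F * Polynomial.derivative
      (lineRestriction q₀ v (G - C r * F)) - lineRestriction q₀ v (G - C r * F) *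
        Polynomial.derivative (lineRestriction q₀ v F)).eval t ≠ 0 := by
    by_contra! h
    exact mul_derivative_sub_ne_zero h1 h2 h3
      (Polynomial.funext fun t => by rw [h t, Polynomial.eval_zero])
  refine ⟨q₀ + t • v, v, fun h => ht ?_⟩
  have hC : lineRestriction q₀ v (C r) = Polynomial.C r := (lineRestriction q₀ v).commutes r
  simp only [firstOrderJet_zero, firstOrderJet_one, ← taylor_lineRestriction,
    Polynomial.taylor_coeff_zero, Polynomial.taylor_coeff_one] at h
  simp only [map_sub, map_mul, hC, Polynomial.eval_sub, Polynomial.eval_mul,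
    Polynomial.derivative_mul, Polynomial.derivative_C, Polynomial.eval_C, zero_mul, zero_add]
  -- Replacing `G - rF` by `G` does not change the Wronskian.
  linear_combination h

theorem lineRestriction_smul_self {F : MvPolynomial (Fin 3) k} {d : ℕ} (hF : F.IsHomogeneous d)
    (r : k) (v : Fin 3 → k) : lineRestriction (r • v) v F =
      Polynomial.C (eval v F) * (Polynomial.X + Polynomial.C r) ^ d := by
  refine Polynomial.funext fun t => ?_
  rw [eval_lineRestriction, ← add_smul, eval_smul_of_isHomogeneous hF]
  simp only [Polynomial.eval_mul, Polynomial.eval_C, Polynomial.eval_pow, Polynomial.eval_add,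
    Polynomial.eval_X]
  ring

/-- If `q` and `v` are dependent, the restrictions of `F` and `G` are multiples of one polynomial,
either a constant or `(t + r)^d`, and the determinant vanishes. -/
theorem crossProduct_ne_zero_of_jet_det_ne_zero {F G : MvPolynomial (Fin 3) k} {d : ℕ}
    (hF : F.IsHomogeneous d) (hG : G.IsHomogeneous d) {q v : Fin 3 → k}
    (h : firstOrderJet q v F 0 * firstOrderJet q v G 1 -
      firstOrderJet q v G 0 * firstOrderJet q v F 1 ≠ 0) : crossProduct q v ≠ 0 := by
  contrapose! h
  simp only [firstOrderJet_zero, firstOrderJet_one]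
  by_cases hv : v = 0
  · have hconst : ∀ H : MvPolynomial (Fin 3) k,
        lineRestriction q v H = Polynomial.C (eval q H) := fun H =>
      Polynomial.funext fun t => by
        rw [eval_lineRestriction, hv, smul_zero, add_zero, Polynomial.eval_C]
    simp [hconst, Polynomial.coeff_C]
  · have hdep : ¬ LinearIndependent k ![v, q] := by
      rw [← crossProduct_ne_zero_iff_linearIndependent, ← cross_anticomm, h, neg_zero]
      exact fun h => h rfl
    rw [LinearIndependent.pair_iff' hv] at hdep
    push Not at hdep
    obtain ⟨r, rfl⟩ := hdep
    rw [lineRestriction_smul_self hF, lineRestriction_smul_self hG]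
    simp only [Polynomial.coeff_C_mul]
    ring

/-- A general 2-dot imposes the expected number of conditions on a linear system. -/
theorem exists_frame_finrank_inf_comap_dot_le {d : ℕ}
    (V : Submodule k (MvPolynomial (Fin 3) k)) (hV : V ≤ homogeneousSubmodule (Fin 3) k d) :
    ∃ M N : Matrix (Fin 3) (Fin 3) k, M * N = 1 ∧ Module.finrank k
      (V ⊓ ((exponentIdeal k dotExponents).comap (frameSubst M)).restrictScalars k :
        Submodule k (MvPolynomial (Fin 3) k)) ≤ Module.finrank k V - 2 := by
  have : Module.Finite k V := Submodule.finiteDimensional_of_le hV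
  rcases Nat.lt_trichotomy 1 (Module.finrank k V) with h | h | h
  · obtain ⟨F₀, hF₀⟩ : ∃ F : V, F ≠ 0 := by
      by_contra! h0
      have : Subsingleton V := ⟨fun x y => by rw [h0 x, h0 y]⟩
      rw [Module.finrank_zero_of_subsingleton] at h
      omega
    obtain ⟨G₀, hFG⟩ := exists_linearIndependent_pair_of_one_lt_finrank h hF₀
    have hFG' : LinearIndependent k ![(F₀ : MvPolynomial (Fin 3) k), G₀] := by
      have hcomp : (![(F₀ : MvPolynomial (Fin 3) k), G₀] : Fin 2 → _) =
          V.subtype ∘ ![F₀, G₀] := by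
        funext i
        fin_cases i <;> rfl
      rw [hcomp]
      exact hFG.map' V.subtype V.ker_subtype
    obtain ⟨q, v, hqv⟩ := exists_jet_det_ne_zero hFG'
    obtain ⟨M, N, hMN, rfl, rfl⟩ := exists_frame_of_crossProduct_ne_zero
      (crossProduct_ne_zero_of_jet_det_ne_zero (hV F₀.2) (hV G₀.2) hqv)
    refine ⟨M, N, hMN, ?_⟩
    have hle := finrank_inf_comap_dot_add_le M V
    have htop : LinearMap.range ((firstOrderJet (M 0) (M 1)).domRestrict V) = ⊤ := by
      rw [LinearMap.range_eq_top]
      intro y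
      set a := firstOrderJet (M 0) (M 1) F₀ with ha
      set b := firstOrderJet (M 0) (M 1) G₀ with hb
      set D := a 0 * b 1 - b 0 * a 1 with hD
      -- Cramer's rule.
      refine ⟨((y 0 * b 1 - b 0 * y 1) / D) • F₀ + ((a 0 * y 1 - y 0 * a 1) / D) • G₀, ?_⟩
      rw [map_add, map_smul, map_smul, LinearMap.domRestrict_apply, LinearMap.domRestrict_apply,
        ← ha, ← hb]
      ext i
      simp only [Pi.add_apply, Pi.smul_apply, smul_eq_mul]
      fin_cases i
      · simp only [Fin.zero_eta]
        field_simp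
        rw [hD]
        ring
      · simp only [Fin.mk_one]
        field_simp
        rw [hD]
        ring
    rw [htop, finrank_top, Module.finrank_fin_fun] at hle
    omega
  · obtain ⟨F, hF⟩ : ∃ F : V, F ≠ 0 := by
      have : Nontrivial V := Module.nontrivial_of_finrank_pos (R := k) (by omega)
      exact exists_ne 0
    -- The factor `X 0` forces `q ≠ 0`, even when `F` is a constant.
    have hF' : (F : MvPolynomial (Fin 3) k) * X 0 ≠ 0 :=
      mul_ne_zero (by simpa using hF) (X_ne_zero 0)
    obtain ⟨q, hq⟩ : ∃ q, eval q ((F : MvPolynomial (Fin 3) k) * X 0) ≠ 0 := by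
      by_contra! h
      exact hF' (MvPolynomial.funext fun q => by rw [h q, map_zero])
    rw [map_mul, eval_X] at hq
    obtain ⟨M, N, hMN, rfl⟩ := exists_frame_of_ne_zero (q := q) fun h => hq (by simp [h])
    refine ⟨M, N, hMN, ?_⟩
    have hle := finrank_inf_comap_dot_add_le M V
    have hpos : 0 < Module.finrank k
        (LinearMap.range ((firstOrderJet (M 0) (M 1)).domRestrict V)) := by
      rw [Module.finrank_pos_iff_exists_ne_zero]
      refine ⟨⟨_, LinearMap.mem_range_self _ F⟩, fun h0 => left_ne_zero_of_mul hq ?_⟩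
      have h1 : firstOrderJet (M 0) (M 1) (F : MvPolynomial (Fin 3) k) 0 = 0 :=
        congrFun (congrArg Subtype.val h0) 0
      rwa [firstOrderJet_zero, Polynomial.coeff_zero_eq_eval_zero, eval_lineRestriction,
        zero_smul, add_zero] at h1
    omega
  · refine ⟨1, 1, one_mul 1, ?_⟩
    have hle := finrank_inf_comap_dot_add_le 1 V
    omega

end Line

/-! ### Semicontinuity of rank through minors -/

section Semicontinuity

variable {k : Type*} [Field k] {E ι : Type*} [AddCommGroup E] [Module k E]

/-- A functional vanishing on the image is a linear relation among the `f i`. -/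
theorem surjective_pi_of_linearIndependent {κ : Type*} [Finite κ] {f : κ → Module.Dual k E}
    (hf : LinearIndependent k f) : Function.Surjective (LinearMap.pi f) := by
  have := Fintype.ofFinite κ
  rw [← LinearMap.range_eq_top]
  by_contra htop
  obtain ⟨φ, hφ, hle⟩ := Submodule.exists_le_ker_of_lt_top _ (lt_top_iff_ne_top.2 htop)
  classical
  refine hφ (LinearMap.pi_ext' fun i => LinearMap.ext_ring ?_)
  have h0 : ∑ j, φ (Pi.single j 1) • f j = 0 := by
    ext x
    have h1 : φ (LinearMap.pi f x) = 0 := hle (LinearMap.mem_range_self _ x)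
    have hs : ∀ i : κ, (fun j => if i = j then (1 : k) else 0) = Pi.single i 1 := by
      intro i
      ext j
      simp [Pi.single_apply, eq_comm]
    rw [LinearMap.pi_apply_eq_sum_univ φ] at h1
    simp only [hs] at h1
    simp only [LinearMap.sum_apply, LinearMap.smul_apply, LinearMap.zero_apply]
    rw [← h1]
    exact Finset.sum_congr rfl fun j _ => mul_comm _ _
  simpa using Fintype.linearIndependent_iff.1 hf _ h0 i

/-- The rank of a linear system of conditions is detected by a minor. -/
theorem exists_minor_ne_zero [Finite ι] (W : Submodule k E) [Module.Finite k W]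
    (φ : E →ₗ[k] ι → k) :
    ∃ (n : ℕ) (a : Fin n → ι) (G : Fin n → E), (∀ j, G j ∈ W) ∧
      (Matrix.of fun i j => φ (G j) (a i)).det ≠ 0 ∧
      n + Module.finrank k (W ⊓ LinearMap.ker φ : Submodule k E) = Module.finrank k W := by
  let f : ι → Module.Dual k W := fun i => LinearMap.proj i ∘ₗ φ.domRestrict W
  -- A maximal independent subfamily of the conditions has the same common kernel, and on vectors
  -- dual to it the minor is the identity matrix.
  obtain ⟨κ, b, hb, hspan, hlin⟩ := exists_linearIndependent' k f
  have := Finite.of_injective b hb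
  obtain ⟨n, ⟨e⟩⟩ := Finite.exists_equiv_fin κ
  have hlin' : LinearIndependent k (f ∘ b ∘ e.symm) := hlin.comp _ e.symm.injective
  have hsurj := surjective_pi_of_linearIndependent hlin'
  choose G hG using fun j : Fin n => hsurj (Pi.single j 1)
  refine ⟨n, b ∘ e.symm, fun j => G j, fun j => (G j).2, ?_, ?_⟩
  · have h1 : (Matrix.of fun i j => φ (G j) ((b ∘ e.symm) i)) = 1 := by
      ext i j
      have h2 := congrFun (hG j) i
      rw [LinearMap.pi_apply] at h2
      rw [Matrix.one_apply, Matrix.of_apply]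
      refine h2.trans ?_
      simp [Pi.single_apply]
    rw [h1, Matrix.det_one]
    exact one_ne_zero
  · have hker : LinearMap.ker (LinearMap.pi (f ∘ b ∘ e.symm)) =
        LinearMap.ker (φ.domRestrict W) := by
      ext x
      simp only [LinearMap.mem_ker]
      constructor
      · intro hx
        have hle : Submodule.span k (Set.range f) ≤ LinearMap.ker (Module.Dual.eval k W x) := by
          rw [← hspan, Submodule.span_le]
          rintro _ ⟨i, rfl⟩
          have := congrFun hx (e i)
          simpa using this
        ext i
        exact hle (Submodule.subset_span ⟨i, rfl⟩)
      · intro hx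
        ext i
        exact congrFun hx _
    have h1 := LinearMap.finrank_range_add_finrank_ker (LinearMap.pi (f ∘ b ∘ e.symm))
    rw [LinearMap.range_eq_top.2 hsurj, finrank_top, Module.finrank_fin_fun, hker] at h1
    rw [← h1, ← Submodule.map_comap_subtype, Submodule.finrank_map_subtype_eq,
      LinearMap.ker_domRestrict]

/-- A minor found for one `φ` is reused for a different `φ`: as long as it is nonzero, the images of
the `G j` remain independent and the rank is at least `n`. -/
theorem add_finrank_le_of_minor_ne_zero [Finite ι] (W : Submodule k E) [Module.Finite k W]
    (φ : E →ₗ[k] ι → k) {n : ℕ} (a : Fin n → ι) {G : Fin n → E} (hG : ∀ j, G j ∈ W)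
    (hdet : (Matrix.of fun i j => φ (G j) (a i)).det ≠ 0) :
    n + Module.finrank k (W ⊓ LinearMap.ker φ : Submodule k E) ≤ Module.finrank k W := by
  rw [← finrank_inf_ker_add_finrank_range W φ, add_comm n]
  refine Nat.add_le_add_left ?_ _
  have hlin : LinearIndependent k
      fun j => (⟨φ (G j), ⟨⟨G j, hG j⟩, rfl⟩⟩ : LinearMap.range (φ.domRestrict W)) := by
    have h1 := Matrix.linearIndependent_cols_of_det_ne_zero hdet
    refine LinearIndependent.of_comp
      ((LinearMap.funLeft k k a) ∘ₗ (LinearMap.range (φ.domRestrict W)).subtype) ?_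
    exact h1
  simpa using hlin.fintype_card_le_finrank

end Semicontinuity

/-! ### Multihomogeneity of coefficients and determinants -/

section Multihomogeneous

variable {k : Type*} [Field k] {s : ℕ}

/-- The degree of an entry depends on its row only, and each Leibniz term takes one entry from every
row. -/
theorem isMultihomogeneous_det {n : Type*} [Fintype n] [DecidableEq n]
    {A : Matrix n n (MvPolynomial (Block s × Fin 3) k)} {e : n → Block s →₀ ℕ}
    (hA : ∀ i j, IsMultihomogeneous (A i j) (e i)) : IsMultihomogeneous A.det (∑ i, e i) := by
  rw [← Matrix.det_transpose, Matrix.det_apply]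
  refine IsWeightedHomogeneous.sum _ _ _ fun σ _ => ?_
  rw [Units.smul_def, zsmul_eq_mul, ← map_intCast (C : k →+* MvPolynomial (Block s × Fin 3) k)]
  exact IsWeightedHomogeneous.C_mul
    (IsWeightedHomogeneous.prod Finset.univ _ _ fun i _ => hA i (σ i)) _

theorem isMultihomogeneous_coeff_mul {D : Fin 3 → Block s →₀ ℕ}
    {G H : MvPolynomial (Fin 3) (MvPolynomial (Block s × Fin 3) k)}
    (hG : ∀ α, IsMultihomogeneous (coeff α G) (∑ i, α i • D i))
    (hH : ∀ α, IsMultihomogeneous (coeff α H) (∑ i, α i • D i)) (α : Fin 3 →₀ ℕ) :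
    IsMultihomogeneous (coeff α (G * H)) (∑ i, α i • D i) := by
  rw [coeff_mul]
  refine IsWeightedHomogeneous.sum _ _ _ fun x hx => ?_
  rw [← Finset.HasAntidiagonal.mem_antidiagonal.1 hx]
  simp only [Finsupp.add_apply, add_smul, Finset.sum_add_distrib]
  exact (hG _).mul (hH _)

/-- Each factor `y_i` in a monomial is accompanied by an entry of row `i`, so the degree is
determined by `α` alone, whatever `F` is. -/
theorem isMultihomogeneous_coeff_frameSubst {D : Fin 3 → Block s →₀ ℕ}
    {M : Matrix (Fin 3) (Fin 3) (MvPolynomial (Block s × Fin 3) k)}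
    (hM : ∀ i j, IsMultihomogeneous (M i j) (D i)) (F : MvPolynomial (Fin 3) k)
    (α : Fin 3 →₀ ℕ) :
    IsMultihomogeneous (coeff α (frameSubst M (map C F))) (∑ i, α i • D i) := by
  induction F using MvPolynomial.induction_on generalizing α with
  | C r =>
    rw [map_C, frameSubst_C, coeff_C]
    split_ifs with h
    · subst h
      have h0 : IsMultihomogeneous (C r : MvPolynomial (Block s × Fin 3) k) 0 :=
        isWeightedHomogeneous_C _ r
      simpa using h0
    · exact isWeightedHomogeneous_zero _ _ _
  | add F G hF hG =>
    rw [map_add, map_add, coeff_add]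
    exact (hF α).add (hG α)
  | mul_X F j hF =>
    rw [map_mul, map_mul, map_X]
    refine isMultihomogeneous_coeff_mul hF (fun β => ?_) α
    rw [frameSubst_X, coeff_sum]
    refine IsWeightedHomogeneous.sum _ _ _ fun i _ => ?_
    rw [C_mul_X_eq_monomial, coeff_monomial]
    split_ifs with h
    · subst h
      have h1 : ∑ l, (Finsupp.single i 1 : Fin 3 →₀ ℕ) l • D l = D i := by
        simp [Finsupp.single_apply]
      rw [h1]
      exact hM i j
    · exact isWeightedHomogeneous_zero _ _ _

theorem map_frameSubst {R S : Type*} [CommRing R] [CommRing S] (φ : R →+* S)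
    (M : Matrix (Fin 3) (Fin 3) R) (F : MvPolynomial (Fin 3) R) :
    map φ (frameSubst M F) = frameSubst (M.map φ) (map φ F) := by
  induction F using MvPolynomial.induction_on with
  | C r => simp
  | add F G hF hG => simp [hF, hG]
  | mul_X F j hF => simp [hF, frameSubst_X]

end Multihomogeneous

/-! ### The conditions as polynomials in the coordinates -/

section Conditions

/-- A frame at the point with coordinates `p`. -/
def pointFrame {R : Type*} [CommRing R] (p : Fin 3 → R) : Matrix (Fin 3) (Fin 3) R :=
  Matrix.of ![p, ![0, 1, 0], ![0, 0, 1]]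

/-- A frame at the dot with support `q` on the line `a`, depending on auxiliary vectors. -/
def dotFrame {R : Type*} [CommRing R] (q a u w : Fin 3 → R) : Matrix (Fin 3) (Fin 3) R :=
  Matrix.of ![q, crossProduct u a, w]

theorem pointFrame_map {R S : Type*} [CommRing R] [CommRing S] (φ : R →+* S) (p : Fin 3 → R) :
    (pointFrame p).map φ = pointFrame (φ ∘ p) := by
  ext i j
  fin_cases i <;> fin_cases j <;> simp [pointFrame]

theorem dotFrame_map {R S : Type*} [CommRing R] [CommRing S] (φ : R →+* S)
    (q a u w : Fin 3 → R) :
    (dotFrame q a u w).map φ = dotFrame (φ ∘ q) (φ ∘ a) (φ ∘ u) (φ ∘ w) := by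
  ext i j
  fin_cases i <;> fin_cases j <;> simp [dotFrame, cross_apply]

/-- The linear conditions imposed by `mP + Z₁ + ⋯ + Z_s` on forms of degree `d`. -/
abbrev Condition (s m d : ℕ) : Type :=
  residualExponents (fatExponents m) d ⊕ Fin s × residualExponents dotExponents d

variable {s m d : ℕ}

/-- The exponent whose coefficient has to vanish. -/
def Condition.exponent : Condition s m d → Fin 3 →₀ ℕ
  | Sum.inl α => α
  | Sum.inr x => x.2

/-- The frame in which the exponent of a condition is to be read. -/
def Condition.frame {R : Type*} [CommRing R] (c : Block s → Fin 3 → R) (u w : Fin s → Fin 3 → R) :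
    Condition s m d → Matrix (Fin 3) (Fin 3) R
  | Sum.inl _ => pointFrame (c Block.point)
  | Sum.inr x => dotFrame (c (Block.support x.1)) (c (Block.line x.1)) (u x.1) (w x.1)

variable {k : Type*} [Field k]

/-- The system of all conditions for given coordinates. -/
noncomputable def conditionMap (m d : ℕ) (c : Block s → Fin 3 → k) (u w : Fin s → Fin 3 → k) :
    MvPolynomial (Fin 3) k →ₗ[k] Condition s m d → k :=
  LinearMap.pi fun r => lcoeff k r.exponent ∘ₗ (frameSubst (r.frame c u w)).toLinearMap

theorem conditionMap_apply (c : Block s → Fin 3 → k) (u w : Fin s → Fin 3 → k)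
    (F : MvPolynomial (Fin 3) k) (r : Condition s m d) :
    conditionMap m d c u w F r = coeff r.exponent (frameSubst (r.frame c u w) F) := rfl

/-- The conditions as polynomials in the coordinates. -/
noncomputable def genericCondition (u w : Fin s → Fin 3 → k) (F : MvPolynomial (Fin 3) k)
    (r : Condition s m d) : MvPolynomial (Block s × Fin 3) k :=
  coeff r.exponent (frameSubst (r.frame (fun b j => X (b, j)) (fun i j => C (u i j))
    fun i j => C (w i j)) (map C F))

theorem Condition.frame_map {R S : Type*} [CommRing R] [CommRing S] (φ : R →+* S)
    (c : Block s → Fin 3 → R) (u w : Fin s → Fin 3 → R) (r : Condition s m d) :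
    (r.frame c u w).map φ =
      r.frame (fun b => φ ∘ c b) (fun i => φ ∘ u i) (fun i => φ ∘ w i) := by
  rcases r with α | x
  · exact pointFrame_map φ _
  · exact dotFrame_map φ _ _ _ _

theorem eval_genericCondition (c : Block s → Fin 3 → k) (u w : Fin s → Fin 3 → k)
    (F : MvPolynomial (Fin 3) k) (r : Condition s m d) :
    eval (fun v => c v.1 v.2) (genericCondition u w F r) = conditionMap m d c u w F r := by
  have h : (eval fun v : Block s × Fin 3 => c v.1 v.2).comp C = RingHom.id k := by
    ext r
    simp
  rw [genericCondition, ← coeff_map, map_frameSubst, map_map, h, map_id, Condition.frame_map,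
    conditionMap_apply]
  have h1 : (fun b => (eval fun v : Block s × Fin 3 => c v.1 v.2) ∘ fun j => X (b, j)) = c := by
    ext b j
    simp
  have h2 : ∀ u : Fin s → Fin 3 → k,
      (fun i => (eval fun v : Block s × Fin 3 => c v.1 v.2) ∘ fun j => C (u i j)) = u := by
    intro u
    ext i j
    simp
  rw [h1, h2, h2]

/-- The multidegrees of the vectors of the frame of a condition. -/
noncomputable def Condition.frameDegree : Condition s m d → Fin 3 → Block s →₀ ℕ
  | Sum.inl _ => ![Finsupp.single Block.point 1, 0, 0]
  | Sum.inr x => ![Finsupp.single (Block.support x.1) 1, Finsupp.single (Block.line x.1) 1, 0]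

theorem isMultihomogeneous_pointFrame (i j : Fin 3) :
    IsMultihomogeneous (pointFrame (fun j => (X (Block.point, j) :
      MvPolynomial (Block s × Fin 3) k)) i j) (![Finsupp.single Block.point 1, 0, 0] i) := by
  have hX := isWeightedHomogeneous_X k (fun v : Block s × Fin 3 => Finsupp.single v.1 1)
    (Block.point, j)
  have h0 := isWeightedHomogeneous_zero k
    (fun v : Block s × Fin 3 => (Finsupp.single v.1 1 : Block s →₀ ℕ)) 0
  have h1 := isWeightedHomogeneous_one k
    (fun v : Block s × Fin 3 => (Finsupp.single v.1 1 : Block s →₀ ℕ))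
  fin_cases i
  · exact hX
  · fin_cases j
    exacts [h0, h1, h0]
  · fin_cases j
    exacts [h0, h0, h1]

theorem isMultihomogeneous_dotFrame (u w : Fin 3 → k) (t : Fin s) (i j : Fin 3) :
    IsMultihomogeneous (dotFrame (fun j => (X (Block.support t, j) :
      MvPolynomial (Block s × Fin 3) k)) (fun j => X (Block.line t, j)) (fun j => C (u j))
        (fun j => C (w j)) i j)
      (![Finsupp.single (Block.support t) 1, Finsupp.single (Block.line t) 1, 0] i) := by
  have hX := fun b : Block s => isWeightedHomogeneous_X k
    (fun v : Block s × Fin 3 => (Finsupp.single v.1 1 : Block s →₀ ℕ)) (b, j)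
  fin_cases i
  · exact isWeightedHomogeneous_X k
      (fun v : Block s × Fin 3 => (Finsupp.single v.1 1 : Block s →₀ ℕ)) (Block.support t, j)
  · have hl : ∀ (r : k) (j : Fin 3), IsMultihomogeneous
        (C r * X (Block.line t, j) : MvPolynomial (Block s × Fin 3) k)
        (Finsupp.single (Block.line t) 1) := fun r j =>
      (isWeightedHomogeneous_X k (fun v : Block s × Fin 3 =>
        (Finsupp.single v.1 1 : Block s →₀ ℕ)) (Block.line t, j)).C_mul r
    change IsMultihomogeneous (crossProduct (fun j => C (u j)) (fun j => X (Block.line t, j)) j) _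
    rw [cross_apply]
    fin_cases j
    · exact (hl _ _).sub (hl _ _)
    · exact (hl _ _).sub (hl _ _)
    · exact (hl _ _).sub (hl _ _)
  · exact isWeightedHomogeneous_C _ _

theorem isMultihomogeneous_genericCondition (u w : Fin s → Fin 3 → k)
    (F : MvPolynomial (Fin 3) k) (r : Condition s m d) :
    IsMultihomogeneous (genericCondition u w F r) (∑ i, r.exponent i • r.frameDegree i) := by
  refine isMultihomogeneous_coeff_frameSubst (fun i j => ?_) F _
  rcases r with α | x
  · exact isMultihomogeneous_pointFrame i j
  · exact isMultihomogeneous_dotFrame _ _ _ i j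

theorem homogeneousSubmodule_inf_ker_conditionMap (c : Block s → Fin 3 → k)
    (u w : Fin s → Fin 3 → k) :
    homogeneousSubmodule (Fin 3) k d ⊓ LinearMap.ker (conditionMap m d c u w) =
      (homogeneousSubmodule (Fin 3) k d ⊓ ((exponentIdeal k (fatExponents m)).comap
        (frameSubst (pointFrame (c Block.point)))).restrictScalars k) ⊓
          ⨅ i, ((exponentIdeal k dotExponents).comap (frameSubst (dotFrame (c (Block.support i))
            (c (Block.line i)) (u i) (w i)))).restrictScalars k := by
  ext F
  rw [inf_assoc]
  refine and_congr_right fun hF => ?_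
  simp only [SetLike.mem_coe, Submodule.mem_inf, Submodule.mem_iInf,
    Submodule.restrictScalars_mem, Ideal.mem_comap, LinearMap.mem_ker,
    homogeneous_mem_exponentIdeal_iff (isHomogeneous_frameSubst _ hF), funext_iff]
  constructor
  · exact fun h => ⟨fun α hα => h (Sum.inl ⟨α, hα⟩), fun i α hα => h (Sum.inr (i, ⟨α, hα⟩))⟩
  · rintro ⟨h1, h2⟩ (α | x)
    · exact h1 α.1 α.2
    · exact h2 x.1 x.2.1 x.2.2

/-- An exponent is determined by its last two entries, of sum `j < m`; the first must be `d - j`,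
which is a natural number exactly because `m ≤ d + 1`. -/
theorem card_residualExponents_fatExponents (hmd : m ≤ d + 1) :
    (residualExponents (fatExponents m) d).card = (m + 1).choose 2 := by
  have h : (residualExponents (fatExponents m) d).card =
      ((Finset.range m).sigma fun j => Finset.HasAntidiagonal.antidiagonal j).card := by
    refine Finset.card_nbij' (fun α => ⟨α 1 + α 2, (α 1, α 2)⟩)
      (fun x => exponent (d - x.1) x.2.1 x.2.2) ?_ ?_ ?_ ?_
    · intro α hα
      have hα' := mem_residualExponents.1 (Finset.mem_coe.1 hα)
      rw [mem_fatExponents] at hα'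
      simp only [Finset.coe_sigma, Set.mem_sigma_iff, Finset.mem_coe, Finset.mem_range,
        Finset.HasAntidiagonal.mem_antidiagonal]
      exact ⟨by omega, trivial⟩
    · rintro ⟨j, b, c⟩ hx
      simp only [Finset.coe_sigma, Set.mem_sigma_iff, Finset.mem_coe, Finset.mem_range,
        Finset.HasAntidiagonal.mem_antidiagonal] at hx
      rw [Finset.mem_coe, mem_residualExponents, mem_fatExponents, degree_eq_add]
      simp only [exponent_zero, exponent_one, exponent_two]
      omega
    · intro α hα
      have hα' := mem_residualExponents.1 (Finset.mem_coe.1 hα)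
      rw [degree_eq_add] at hα'
      refine (eq_exponent_iff.2 ⟨?_, rfl, rfl⟩).symm
      simp only
      omega
    · rintro ⟨j, b, c⟩ hx
      simp only [Finset.coe_sigma, Set.mem_sigma_iff, Finset.mem_coe, Finset.mem_range,
        Finset.HasAntidiagonal.mem_antidiagonal] at hx
      obtain ⟨-, rfl⟩ := hx
      rfl
  rw [h, Finset.card_sigma]
  simp only [Finset.Nat.card_antidiagonal]
  clear hmd h
  induction m with
  | zero => rfl
  | succ m ih =>
    rw [Finset.sum_range_succ, ih, Nat.choose_succ_succ' (m + 1) 1, Nat.choose_one_right,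
      add_comm]

/-- Only an inequality, since in degree zero a dot contributes a single condition. This is all that
the lower bound for `h0` needs. -/
theorem card_condition_le (hmd : m ≤ d + 1) :
    Fintype.card (Condition s m d) ≤ (m + 1).choose 2 + 2 * s := by
  rw [Fintype.card_sum, Fintype.card_prod, Fintype.card_coe, Fintype.card_coe, Fintype.card_fin,
    card_residualExponents_fatExponents hmd, mul_comm 2 s]
  refine Nat.add_le_add_left (Nat.mul_le_mul_left _ ?_) _
  rcases Nat.eq_zero_or_pos d with rfl | hd
  · refine (Finset.card_le_card (t := {exponent 0 0 0}) fun α hα => ?_).trans (by simp)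
    have hα' := mem_residualExponents.1 hα
    rw [degree_eq_add] at hα'
    rw [Finset.mem_singleton, eq_exponent_iff]
    omega
  · exact (card_residualExponents_dotExponents hd).le

end Conditions

/-! ### Existence of one good configuration -/

section GoodCoordinates

variable {k : Type*} [Field k]

theorem exists_frames_finrank_inf_iInf_le [CharZero k] {d : ℕ} (s : ℕ)
    (V : Submodule k (MvPolynomial (Fin 3) k)) (hV : V ≤ homogeneousSubmodule (Fin 3) k d) :
    ∃ M N : Fin s → Matrix (Fin 3) (Fin 3) k, (∀ i, M i * N i = 1) ∧ Module.finrank k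
      (V ⊓ ⨅ i, ((exponentIdeal k dotExponents).comap (frameSubst (M i))).restrictScalars k :
        Submodule k (MvPolynomial (Fin 3) k)) ≤ Module.finrank k V - 2 * s := by
  induction s generalizing V with
  | zero => exact ⟨Fin.elim0, Fin.elim0, fun i => i.elim0, by
    rw [iInf_of_empty, inf_top_eq]; simp⟩
  | succ s ih =>
    obtain ⟨M₀, N₀, h₀, hle₀⟩ := exists_frame_finrank_inf_comap_dot_le V hV
    obtain ⟨M, N, h, hle⟩ := ih _ (inf_le_left.trans hV :
      V ⊓ ((exponentIdeal k dotExponents).comap (frameSubst M₀)).restrictScalars k ≤ _)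
    refine ⟨Fin.cons M₀ M, Fin.cons N₀ N, Fin.cases h₀ h, ?_⟩
    have heq : V ⊓ ⨅ i : Fin (s + 1), ((exponentIdeal k dotExponents).comap (frameSubst
        ((Fin.cons M₀ M : Fin (s + 1) → Matrix (Fin 3) (Fin 3) k) i))).restrictScalars k =
        V ⊓ ((exponentIdeal k dotExponents).comap (frameSubst M₀)).restrictScalars k ⊓
          ⨅ i, ((exponentIdeal k dotExponents).comap (frameSubst (M i))).restrictScalars k := by
      ext F
      simp [Fin.forall_fin_succ, and_assoc]
    rw [heq]
    omega

/-- The first column `n` of `N` satisfies `n · M 0 = 1` and `n · M 1 = 0`, so the triple product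
expansion of `-n × (M 0 × M 1)` is `M 1`. Thus every frame has the shape of a `dotFrame`, for
suitable auxiliary vectors. -/
theorem dotFrame_eq {M N : Matrix (Fin 3) (Fin 3) k} (h : M * N = 1) :
    dotFrame (M 0) (crossProduct (M 0) (M 1)) (fun j => -N j 0) (M 2) = M := by
  have h0 := congrFun (congrFun h 0) 0
  have h1 := congrFun (congrFun h 1) 0
  simp only [Matrix.mul_apply, Fin.sum_univ_three, Matrix.one_apply_eq] at h0
  rw [Matrix.one_apply_ne (by decide), Matrix.mul_apply, Fin.sum_univ_three] at h1
  ext i j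
  fin_cases i
  · rfl
  · change crossProduct (fun j => -N j 0) (crossProduct (M 0) (M 1)) j = M 1 j
    simp only [cross_apply]
    fin_cases j
    · simp
      linear_combination M 1 0 * h0 - M 0 0 * h1
    · simp
      linear_combination M 1 1 * h0 - M 0 1 * h1
    · simp
      linear_combination M 1 2 * h0 - M 0 2 * h1
  · rfl

/-- Homogeneous coordinates that represent a configuration. -/
structure IsAdmissible {s : ℕ} (c : Block s → Fin 3 → k) : Prop where
  ne_zero : ∀ b, c b ≠ 0
  incident : ∀ i, c (Block.support i) ⬝ᵥ c (Block.line i) = 0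

theorem det_ne_zero_of_mul_eq_one {M N : Matrix (Fin 3) (Fin 3) k} (h : M * N = 1) : M.det ≠ 0 := by
  intro h0
  have := congrArg Matrix.det h
  rw [Matrix.det_mul, h0, zero_mul, Matrix.det_one] at this
  exact zero_ne_one this

theorem crossProduct_frame_ne_zero {M N : Matrix (Fin 3) (Fin 3) k} (h : M * N = 1) :
    crossProduct (M 0) (M 1) ≠ 0 := by
  rw [crossProduct_ne_zero_iff_linearIndependent]
  have hrows := Matrix.linearIndependent_rows_of_det_ne_zero (det_ne_zero_of_mul_eq_one h)
  have hcomp : ![M 0, M 1] = (fun i => M i) ∘ ![0, 1] := by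
    funext i
    fin_cases i <;> rfl
  rw [hcomp]
  exact hrows.comp ![0, 1] (by decide)

/-- Some configuration of 2-dots imposes independent conditions. -/
theorem exists_good_coordinates [CharZero k] {s m d : ℕ} (hmd : m ≤ d + 1) :
    ∃ (c : Block s → Fin 3 → k) (u w : Fin s → Fin 3 → k), IsAdmissible c ∧
      (pointFrame (c Block.point)).det ≠ 0 ∧
      (∀ i, (dotFrame (c (Block.support i)) (c (Block.line i)) (u i) (w i)).det ≠ 0) ∧
      Module.finrank k (homogeneousSubmodule (Fin 3) k d ⊓
        LinearMap.ker (conditionMap m d c u w) : Submodule k (MvPolynomial (Fin 3) k)) ≤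
          (d + 2).choose 2 - (m + 1).choose 2 - 2 * s := by
  have hone : pointFrame ![1, 0, 0] = (1 : Matrix (Fin 3) (Fin 3) k) := by
    ext i j
    fin_cases i <;> fin_cases j <;> rfl
  obtain ⟨M, N, hMN, hle⟩ := exists_frames_finrank_inf_iInf_le (d := d) s
    (homogeneousSubmodule (Fin 3) k d ⊓ ((exponentIdeal k (fatExponents m)).comap
        (frameSubst 1)).restrictScalars k) inf_le_left
  let c : Block s → Fin 3 → k
    | Block.point => ![1, 0, 0]
    | Block.support i => M i 0
    | Block.line i => crossProduct (M i 0) (M i 1)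
  obtain ⟨u, w, huw⟩ : ∃ u w : Fin s → Fin 3 → k, ∀ i,
      dotFrame (c (Block.support i)) (c (Block.line i)) (u i) (w i) = M i :=
    ⟨fun i j => -N i j 0, fun i => M i 2, fun i => dotFrame_eq (hMN i)⟩
  have hpt : pointFrame (c Block.point) = 1 := hone
  refine ⟨c, u, w, ⟨?_, ?_⟩, ?_, ?_, ?_⟩
  · rintro (_ | i | i)
    · exact fun h => one_ne_zero (congrFun h 0)
    · exact frame_zero_ne_zero (hMN i)
    · exact crossProduct_frame_ne_zero (hMN i)
  · exact fun i => dot_self_cross _ _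
  · rw [hpt, Matrix.det_one]
    exact one_ne_zero
  · intro i
    rw [huw]
    exact det_ne_zero_of_mul_eq_one (hMN i)
  · have heq := homogeneousSubmodule_inf_ker_conditionMap (m := m) (d := d) c u w
    simp only [huw, hpt] at heq
    rw [heq]
    refine hle.trans (Nat.sub_le_sub_right ?_ _)
    have := finrank_inf_comap_exponentIdeal (one_mul (1 : Matrix (Fin 3) (Fin 3) k))
      (fatExponents m) d
    rw [card_residualExponents_fatExponents hmd, finrank_homogeneousSubmodule] at this
    omega

end GoodCoordinates

/-! ### Configurations and their coordinates -/

section Coordinates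

variable {k : Type*} [Field k] {s : ℕ}

theorem mulVec_dotFrame_one (q a u w : Fin 3 → k) : (dotFrame q a u w).mulVec a 1 = 0 := by
  change crossProduct u a ⬝ᵥ a = 0
  rw [dotProduct_comm, dot_cross_self]

theorem Configuration.IsCoordinates.isAdmissible {x : Configuration k s} {c : Block s → Fin 3 → k}
    (hx : x.IsCoordinates c) : IsAdmissible c := by
  refine ⟨?_, fun i => ?_⟩
  · rintro (_ | i | i)
    · exact hx.1.1
    · exact (hx.2 i).1.1
    · exact (hx.2 i).2.1
  · obtain ⟨⟨hq, hsub⟩, -, hmem⟩ := hx.2 i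
    obtain ⟨M, N, hMN, hM⟩ := exists_frame_of_ne_zero hq
    simp only [← hM] at hsub
    have := mulVec_zero_of_linear_mem hMN (hM ▸ hq) hsub (x.isDot i).2 hmem
    rwa [← hM]

theorem exists_dot_of_incident {q a : Fin 3 → k} (hq : q ≠ 0) (ha : a ≠ 0) (hqa : q ⬝ᵥ a = 0) :
    ∃ Z : ClosedSubscheme k 2, IsDot 2 Z ∧
      IsSubscheme Z (fatPoint 2 (Projectivization.mk k q hq)) ∧ ∑ j, C (a j) * X j ∈ Z.ideal := by
  obtain ⟨i, hi⟩ := Function.ne_iff.1 hq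
  -- The vector `a × e_i` is a second point on the line `a`: since `q · a = 0`, its cross product
  -- with `q` is `q_i a`, which is nonzero.
  have hv : crossProduct q (crossProduct a (Pi.single i 1)) ≠ 0 := by
    rw [cross_cross_eq_smul_sub_smul', dotProduct_comm a, hqa]
    simpa using ⟨hi, ha⟩
  obtain ⟨M, N, hMN, rfl, hM1⟩ := exists_frame_of_crossProduct_ne_zero hv
  refine ⟨frameDot M hq, isDot_frameDot hMN hq, isSubscheme_frameDot hMN hq,
    linear_mem_frameDot hq hqa ?_⟩
  change M 1 ⬝ᵥ a = 0
  rw [hM1, dotProduct_comm, dot_self_cross]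

theorem IsAdmissible.exists_configuration {c : Block s → Fin 3 → k} (hc : IsAdmissible c) :
    ∃ x : Configuration k s, x.IsCoordinates c := by
  choose Z hZ hsub hmem using fun i =>
    exists_dot_of_incident (hc.ne_zero (Block.support i)) (hc.ne_zero (Block.line i)) (hc.incident i)
  exact ⟨⟨Projectivization.mk k _ (hc.ne_zero Block.point), Z, hZ⟩, ⟨_, rfl⟩,
    fun i => ⟨⟨_, hsub i⟩, hc.ne_zero _, hmem i⟩⟩

/-- The forms in the ideal of a configuration, in terms of its coordinates. -/
theorem h0_scheme_eq {x : Configuration k s} {c : Block s → Fin 3 → k} (hx : x.IsCoordinates c)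
    {u w : Fin s → Fin 3 → k} (hp : (pointFrame (c Block.point)).det ≠ 0)
    (hdot : ∀ i, (dotFrame (c (Block.support i)) (c (Block.line i)) (u i) (w i)).det ≠ 0)
    (m d : ℕ) : h0 (x.scheme m) d = Module.finrank k (homogeneousSubmodule (Fin 3) k d ⊓
      LinearMap.ker (conditionMap m d c u w) : Submodule k (MvPolynomial (Fin 3) k)) := by
  obtain ⟨⟨hp0, hpx⟩, hdots⟩ := hx
  have hmul : ∀ M : Matrix (Fin 3) (Fin 3) k, M.det ≠ 0 → M * M⁻¹ = 1 := fun M h =>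
    Matrix.mul_nonsing_inv _ (isUnit_iff_ne_zero.2 h)
  rw [homogeneousSubmodule_inf_ker_conditionMap, inf_assoc]
  have heq : (x.scheme m).ideal.restrictScalars k =
      ((exponentIdeal k (fatExponents m)).comap
        (frameSubst (pointFrame (c Block.point)))).restrictScalars k ⊓
          ⨅ i, ((exponentIdeal k dotExponents).comap (frameSubst (dotFrame (c (Block.support i))
            (c (Block.line i)) (u i) (w i)))).restrictScalars k := by
    ext F
    simp only [Submodule.mem_inf, Submodule.mem_iInf, Submodule.restrictScalars_mem,
      Ideal.mem_comap]
    refine Iff.trans Submodule.mem_inf (and_congr ?_ ((Submodule.mem_iInf _).trans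
      (forall_congr' fun i => ?_)))
    · rw [← hpx]
      exact mem_fatPoint_iff (hmul _ hp) hp0 m F
    · obtain ⟨⟨hq, hsub⟩, ha, hmem⟩ := hdots i
      exact mem_dot_iff (hmul _ (hdot i)) hq hsub (x.isDot i).2 ha hmem
        (mulVec_dotFrame_one _ _ _ _) F
  rw [← heq]
  rfl

end Coordinates

/-! ### Irreducibility of the parameter space -/

section Density

variable {k : Type*} [Field k] {s : ℕ}

/-- Every admissible system of coordinates is of this form: the line is spanned by a vector
orthogonal to the support. -/
def incidenceParam {R : Type*} [CommRing R] (e : Block s → Fin 3 → R) : Block s → Fin 3 → R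
  | Block.line i => crossProduct (e (Block.line i)) (e (Block.support i))
  | b => e b

/-- If `n · q = 1` and `q · l = 0`, then `(n × l) × q = l`; take for `n` a multiple of a unit
vector. -/
theorem IsAdmissible.exists_incidenceParam {c : Block s → Fin 3 → k} (hc : IsAdmissible c) :
    ∃ e, incidenceParam e = c := by
  choose j hj using fun i => Function.ne_iff.1 (hc.ne_zero (Block.support i))
  refine ⟨fun
    | Block.line i => crossProduct (Pi.single (j i) (c (Block.support i) (j i))⁻¹)
        (c (Block.line i))
    | b => c b, ?_⟩
  funext b
  rcases b with _ | i | i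
  · rfl
  · rfl
  · change crossProduct (crossProduct _ _) (c (Block.support i)) = _
    rw [cross_cross_eq_smul_sub_smul, dotProduct_comm (c (Block.line i)), hc.incident i,
      single_dotProduct, inv_mul_cancel₀ (hj i), one_smul, zero_smul, sub_zero]

/-- Pull-back of polynomials along the parametrization of the incidence variety. -/
noncomputable def incidencePullback : MvPolynomial (Block s × Fin 3) k →ₐ[k]
    MvPolynomial (Block s × Fin 3) k :=
  aeval fun v => incidenceParam (fun b j => (X (b, j) : MvPolynomial (Block s × Fin 3) k)) v.1 v.2

theorem eval_incidencePullback (e : Block s → Fin 3 → k) (g : MvPolynomial (Block s × Fin 3) k) :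
    eval (fun v => e v.1 v.2) (incidencePullback g) =
      eval (fun v => incidenceParam e v.1 v.2) g := by
  have : (aeval (R := k) fun v : Block s × Fin 3 => e v.1 v.2).comp incidencePullback =
      aeval (R := k) fun v : Block s × Fin 3 => incidenceParam e v.1 v.2 := by
    refine algHom_ext fun v => ?_
    obtain ⟨b, j⟩ := v
    rcases b with _ | i | i
    · simp [incidencePullback, incidenceParam]
    · simp [incidencePullback, incidenceParam]
    · fin_cases j <;> simp [incidencePullback, incidenceParam, cross_apply]
  simpa [aeval_eq_eval] using DFunLike.congr_fun this g

/-- Nonemptiness of open sets thereby becomes nonvanishing in a domain, where it is stable under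
products. -/
theorem incidencePullback_ne_zero {x : Configuration k s} {g : MvPolynomial (Block s × Fin 3) k}
    (hx : x ∈ basicOpen g) : incidencePullback g ≠ 0 := by
  obtain ⟨c, hc, hg⟩ := hx
  obtain ⟨e, rfl⟩ := hc.isAdmissible.exists_incidenceParam
  rw [← eval_incidencePullback] at hg
  intro h
  rw [h, map_zero] at hg
  exact hg rfl

theorem exists_polynomial_of_mem_sInter {S : Set (Set (Configuration k s))} (hfin : S.Finite)
    (hS : ∀ t ∈ S, ∃ g : MvPolynomial (Block s × Fin 3) k, t = basicOpen g)
    {x : Configuration k s} (hx : x ∈ ⋂₀ S) :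
    ∃ G : MvPolynomial (Block s × Fin 3) k, G ≠ 0 ∧ ∀ e : Block s → Fin 3 → k,
      eval (fun v => e v.1 v.2) G ≠ 0 →
        ∀ y : Configuration k s, y.IsCoordinates (incidenceParam e) → y ∈ ⋂₀ S := by
  induction S, hfin using Set.Finite.induction_on with
  | empty => exact ⟨1, one_ne_zero, by simp⟩
  | @insert t S _ _ ih =>
    rw [Set.sInter_insert] at hx
    obtain ⟨G, hG, hGS⟩ := ih (fun t ht => hS t (Set.mem_insert_of_mem _ ht)) hx.2
    obtain ⟨g, rfl⟩ := hS t (Set.mem_insert _ _)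
    refine ⟨incidencePullback g * G, mul_ne_zero (incidencePullback_ne_zero hx.1) hG,
      fun e he y hy => ?_⟩
    rw [map_mul, eval_incidencePullback] at he
    rw [Set.sInter_insert]
    exact ⟨⟨_, hy, left_ne_zero_of_mul he⟩, hGS e (right_ne_zero_of_mul he) y hy⟩

/-- The product of one nonzero coordinate from each block. It keeps the parametrization away from
vectors where a cross product degenerates to zero. -/
theorem IsAdmissible.exists_eval_ne_zero {c : Block s → Fin 3 → k} (hc : IsAdmissible c) :
    ∃ g : MvPolynomial (Block s × Fin 3) k, eval (fun v => c v.1 v.2) g ≠ 0 ∧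
      ∀ e : Block s → Fin 3 → k, eval (fun v => e v.1 v.2) g ≠ 0 → ∀ b, e b ≠ 0 := by
  choose j hj using fun b => Function.ne_iff.1 (hc.ne_zero b)
  refine ⟨X (Block.point, j Block.point) * ∏ i, (X (Block.support i, j (Block.support i)) *
    X (Block.line i, j (Block.line i))), ?_, fun e he => ?_⟩
  · simp only [map_mul, map_prod, eval_X]
    exact mul_ne_zero (hj _) (Finset.prod_ne_zero_iff.2 fun i _ => mul_ne_zero (hj _) (hj _))
  · simp only [map_mul, map_prod, eval_X] at he
    have h1 := left_ne_zero_of_mul he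
    have h2 := fun i => Finset.prod_ne_zero_iff.1 (right_ne_zero_of_mul he) i (Finset.mem_univ i)
    rintro (_ | i | i) h0
    · exact h1 (congrFun h0 _)
    · exact left_ne_zero_of_mul (h2 i) (congrFun h0 _)
    · exact right_ne_zero_of_mul (h2 i) (congrFun h0 _)

/-- The parameter space of configurations is irreducible. -/
theorem dense_basicOpen [Infinite k] {g : MvPolynomial (Block s × Fin 3) k}
    (hg : (basicOpen g).Nonempty) : Dense (basicOpen g) := by
  rw [(TopologicalSpace.isTopologicalBasis_of_subbasis
    (rfl : zariskiTopology k s = TopologicalSpace.generateFrom _)).dense_iff]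
  rintro _ ⟨S, ⟨hfin, hS⟩, rfl⟩ ⟨y, hy⟩
  obtain ⟨G, hG, hGS⟩ := exists_polynomial_of_mem_sInter hfin
    (fun t ht => let ⟨g, _, _, h⟩ := hS ht; ⟨g, h⟩) hy
  obtain ⟨x, hx⟩ := hg
  have hx' := hx
  obtain ⟨c, hc, -⟩ := hx'
  obtain ⟨p, hpc, hp⟩ := hc.isAdmissible.exists_eval_ne_zero
  -- The three factors put the new point in the given basic set, in `basicOpen g`, and among
  -- admissible coordinates; incidence is automatic for a cross product.
  have hne : G * (incidencePullback g * incidencePullback p) ≠ 0 :=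
    mul_ne_zero hG (mul_ne_zero (incidencePullback_ne_zero hx)
      (incidencePullback_ne_zero (x := x) ⟨c, hc, hpc⟩))
  obtain ⟨e, he⟩ : ∃ e, eval e (G * (incidencePullback g * incidencePullback p)) ≠ 0 := by
    by_contra! h
    exact hne (MvPolynomial.funext fun e => by rw [h e, map_zero])
  obtain ⟨e, rfl⟩ : ∃ e' : Block s → Fin 3 → k, (fun v => e' v.1 v.2) = e :=
    ⟨fun b j => e (b, j), rfl⟩
  rw [map_mul, map_mul, eval_incidencePullback, eval_incidencePullback] at he
  have he2 := right_ne_zero_of_mul he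
  have hadm : IsAdmissible (incidenceParam e) :=
    ⟨hp _ (right_ne_zero_of_mul he2), fun i => dot_cross_self _ _⟩
  obtain ⟨z, hz⟩ := hadm.exists_configuration
  exact ⟨z, hGS e (left_ne_zero_of_mul he) z hz, _, hz, left_ne_zero_of_mul he2⟩

theorem isOpen_basicOpen {g : MvPolynomial (Block s × Fin 3) k} {e : Block s →₀ ℕ}
    (hg : IsMultihomogeneous g e) : IsOpen (basicOpen g) :=
  TopologicalSpace.isOpen_generateFrom_of_mem ⟨g, e, hg, rfl⟩

end Density

/-! ### Evaluation of the determinants, and the conclusion -/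

section Determinants

variable {k : Type*} [Field k] {s m d : ℕ}

theorem eval_det_pointFrame (c : Block s → Fin 3 → k) :
    eval (fun v => c v.1 v.2) (pointFrame fun j => (X (Block.point, j) :
      MvPolynomial (Block s × Fin 3) k)).det = (pointFrame (c Block.point)).det := by
  rw [RingHom.map_det, RingHom.mapMatrix_apply, pointFrame_map]
  congr 2
  ext j
  simp

theorem eval_det_dotFrame (c : Block s → Fin 3 → k) (u w : Fin 3 → k) (i : Fin s) :
    eval (fun v => c v.1 v.2) (dotFrame (fun j => (X (Block.support i, j) :
      MvPolynomial (Block s × Fin 3) k)) (fun j => X (Block.line i, j)) (fun j => C (u j))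
        (fun j => C (w j))).det =
      (dotFrame (c (Block.support i)) (c (Block.line i)) u w).det := by
  rw [RingHom.map_det, RingHom.mapMatrix_apply, dotFrame_map]
  congr 2 <;> ext j <;> simp

theorem eval_det_genericCondition (c : Block s → Fin 3 → k) (u w : Fin s → Fin 3 → k) {n : ℕ}
    (a : Fin n → Condition s m d) (G : Fin n → MvPolynomial (Fin 3) k) :
    eval (fun v => c v.1 v.2) (Matrix.of fun i j => genericCondition u w (G j) (a i)).det =
      (Matrix.of fun i j => conditionMap m d c u w (G j) (a i)).det := by
  rw [RingHom.map_det, RingHom.mapMatrix_apply]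
  congr 1
  ext i j
  exact eval_genericCondition c u w (G j) (a i)

end Determinants

/-- A multihomogeneous polynomial whose nonvanishing guarantees good postulation. -/
theorem exists_multihomogeneous_good_postulation {k : Type*} [Field k] [CharZero k] {s m d : ℕ}
    (hmd : m ≤ d + 1) : ∃ (g : MvPolynomial (Block s × Fin 3) k) (e : Block s →₀ ℕ),
      IsMultihomogeneous g e ∧ (basicOpen g).Nonempty ∧ ∀ x ∈ basicOpen g,
        (h0 (x.scheme m) d : ℤ) =
          max (((d + 2).choose 2 : ℤ) - ((m + 1).choose 2 : ℤ) - 2 * (s : ℤ)) 0 := by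
  obtain ⟨c₀, u, w, hadm, hpoint, hdot, hle⟩ := exists_good_coordinates (k := k) (s := s) hmd
  obtain ⟨n, a, G, hG, hdet, hn⟩ := exists_minor_ne_zero (homogeneousSubmodule (Fin 3) k d)
    (conditionMap m d c₀ u w)
  -- The minor controls the rank of the conditions; the other determinants guarantee that the frames
  -- are invertible, so that the conditions compute the ideal of the scheme.
  let minor : MvPolynomial (Block s × Fin 3) k :=
    (Matrix.of fun i j => genericCondition u w (G j) (a i)).det
  let pointDet : MvPolynomial (Block s × Fin 3) k :=
    (pointFrame fun j => X (Block.point, j)).det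
  let dotDet : Fin s → MvPolynomial (Block s × Fin 3) k := fun i =>
    (dotFrame (fun j => X (Block.support i, j)) (fun j => X (Block.line i, j))
      (fun j => C (u i j)) (fun j => C (w i j))).det
  have heval : ∀ c : Block s → Fin 3 → k,
      eval (fun v => c v.1 v.2) (minor * (pointDet * ∏ i, dotDet i)) =
        (Matrix.of fun i j => conditionMap m d c u w (G j) (a i)).det *
          ((pointFrame (c Block.point)).det *
            ∏ i, (dotFrame (c (Block.support i)) (c (Block.line i)) (u i) (w i)).det) := by
    intro c
    rw [map_mul, map_mul, map_prod, eval_det_genericCondition, eval_det_pointFrame]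
    simp only [dotDet, eval_det_dotFrame]
  refine ⟨minor * (pointDet * ∏ i, dotDet i), _,
    (isMultihomogeneous_det fun i j => isMultihomogeneous_genericCondition u w (G j) (a i)).mul
      ((isMultihomogeneous_det isMultihomogeneous_pointFrame).mul
        (IsWeightedHomogeneous.prod _ _ _ fun i _ =>
          isMultihomogeneous_det (isMultihomogeneous_dotFrame (u i) (w i) i))), ?_, ?_⟩
  · obtain ⟨x, hx⟩ := hadm.exists_configuration
    refine ⟨x, c₀, hx, ?_⟩
    rw [heval]
    exact mul_ne_zero hdet (mul_ne_zero hpoint (Finset.prod_ne_zero_iff.2 fun i _ => hdot i))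
  · rintro x ⟨c, hc, hg⟩
    rw [heval] at hg
    have hminor := add_finrank_le_of_minor_ne_zero (homogeneousSubmodule (Fin 3) k d)
      (conditionMap m d c u w) a hG (left_ne_zero_of_mul hg)
    have hg2 := right_ne_zero_of_mul hg
    rw [h0_scheme_eq hc (left_ne_zero_of_mul hg2)
      (fun i => Finset.prod_ne_zero_iff.1 (right_ne_zero_of_mul hg2) i (Finset.mem_univ i))]
    have hrank := finrank_inf_ker_add_finrank_range (homogeneousSubmodule (Fin 3) k d)
      (conditionMap m d c u w)
    -- Counting conditions bounds the kernel from below; the minor bounds it above by its dimension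
    -- at the good configuration. The truncated subtraction in `hle` is the maximum with zero.
    have hrange : Module.finrank k (LinearMap.range ((conditionMap m d c u w).domRestrict
        (homogeneousSubmodule (Fin 3) k d))) ≤ (m + 1).choose 2 + 2 * s := by
      refine (Submodule.finrank_le _).trans ?_
      rw [Module.finrank_fintype_fun_eq_card]
      exact card_condition_le hmd
    rw [finrank_homogeneousSubmodule] at hn hminor hrank
    omega

end Postulation

theorem lemma2p6 {k : Type*} [Field k] [IsAlgClosed k] [CharZero k]
    (s m d : ℕ) (hd : (m : ℤ) - 1 ≤ (d : ℤ)) :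
    Postulation.ForGeneric (fun x : Postulation.Configuration k s =>
      (Postulation.h0 (x.scheme m) d : ℤ) =
        max (((d + 2).choose 2 : ℤ) - ((m + 1).choose 2 : ℤ) - 2 * (s : ℤ)) 0) := by
  obtain ⟨g, e, hg, hne, hgood⟩ :=
    Postulation.exists_multihomogeneous_good_postulation (k := k) (s := s) (m := m) (d := d)
      (by omega)
  exact ⟨Postulation.basicOpen g, Postulation.isOpen_basicOpen hg, hne,
    Postulation.dense_basicOpen hne, hgood⟩
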